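/- **Setting.** Let $S$ be a closed connected oriented polyhedral surface of genus $g\ge 1$ (an oriented closed surface with a piecewise flat metric having isolated conical singularities), and let $T$ be a geodesic triangulation of $S$ whose faces are flat nondegenerate Euclidean triangles; that is, $S$ is glued from finitely many such triangles along isometric sides, with orientations matching (sides of the same triangle may be glued to each other, and vertices of a triangle may coincide in $S$). For an edge $e$ put $c(e)=\frac12\cot\alpha_e+\frac12\cot\beta_e$, where $\alpha_e,\beta_e$ are the angles opposite to $e$ in the two triangles adjacent to $e$. Let $p\colon\widetilde T\to T$ be the universal covering, with sets $\widetilde T^0$, $\widetilde T^2$ of vertices and faces and with a base point $z_0$ that is a vertex of $\widetilde T$. Let $\alpha_1,\dots,\alpha_g,\beta_1,\dots,\beta_g$ be closed edge paths in $T$ based at $p z_0$ forming a standard basis of $\pi_1(S,pz_0)$: they generate it, the path $\alpha_1\beta_1\alpha_1^{-1}\beta_1^{-1}\cdots\alpha_g\beta_g\alpha_g^{-1}\beta_g^{-1}$ is null-homotopic, and the basis is compatible with the orientation of $S$ (the $4g$-gon whose counterclockwise boundary reads this path is mapped to $S$ with positive degree). For a closed path $\gamma$ based at $pz_0$, let $d_\gamma$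 be the deck transformation of $\widetilde T$ taking $z_0$ to the endpoint of the lift of $\gamma$ starting at $z_0$. A *discrete Abelian integral of the 1st kind* with periods $A_1,\dots,A_g,B_1,\dots,B_g\in\mathbb C$ is a pair of functions $f=(\operatorname{Re} f\colon\widetilde T^0\to\mathbb R,\ \operatorname{Im} f\colon\widetilde T^2\to\mathbb R)$ such that: 1. for each oriented edge $e$ of $\widetilde T$ with head $h_e$, tail $t_e$, left face $l_e$ and right face $r_e$, $$[\operatorname{Im} f](l_e)-[\operatorname{Im} f](r_e)=c(pe)\bigl([\operatorname{Re} f](h_e)-[\operatorname{Re} f](t_e)\bigr);$$ 2. for all $k=1,\dots,g$, $z\in\widetilde T^0$, $w\in\widetilde T^2$, $$[\operatorname{Re} f](d_{\alpha_k}z)-[\operatorname{Re} f](z)=\operatorname{Re}A_k,\qquad [\operatorname{Re} f](d_{\beta_k}z)-[\operatorname{Re} f](z)=\operatorname{Re}B_k,$$ $$[\operatorname{Im} f](d_{\alpha_k}w)-[\operatorname{Im} f](w)=\operatorname{Im}A_k,\qquad [\operatorname{Im} f](d_{\beta_k}w)-[\operatorname{Im} f](w)=\operatorname{Im}B_k.$$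 The *period matrix* $\Pi_T$ is the $g\times g$ complex matrix whose $l$-th column consists of the B-periods of a discrete Abelian integral of the 1st kind with A-periods $A_k=\delta_{kl}$. The *dual period matrix* $\Pi_{T^*}$ is the $g\times g$ complex matrix whose $l$-th column consists of the B-periods, divided by $i$, of a discrete Abelian integral of the 1st kind with A-periods $A_k=i\,\delta_{kl}$. **Lemma.** The matrices $\Pi_T$ and $\Pi_{T^*}$ exist and are uniquely determined. The real matrices $\operatorname{Im}\Pi_T$ and $\operatorname{Im}\Pi_{T^*}$ are symmetric and positive definite, and $\operatorname{Re}\Pi_{T^*}=(\operatorname{Re}\Pi_T)^{\mathrm T}$. -/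

import Mathlib

open scoped Matrix

/-- A connected oriented triangulated polyhedral surface without boundary (closed when the type `D`
is finite), obtained by gluing flat Euclidean triangles along their sides by orientation-reversing
isometries. It is recorded by its oriented edges `D`: each oriented edge `d` is
a side of exactly one triangle, the one lying to the left of `d`; `next d` is the side of this
triangle that follows `d` counterclockwise; `twin d` is the same edge with the opposite orientation.
The metric is recorded by the side lengths `len`, which satisfy the strict triangle inequality.
Two sides of one triangle may be glued to each other, and the vertices of a triangle need not be
distinct on the surface (so that, e.g., a torus glued from two triangles is allowed). -/
structure TriangulatedSurface (D : Type*) where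
  next : Equiv.Perm D
  twin : Equiv.Perm D
  len : D → ℝ
  next_next_next : ∀ d, next (next (next d)) = d
  next_ne : ∀ d, next d ≠ d
  twin_twin : ∀ d, twin (twin d) = d
  twin_ne : ∀ d, twin d ≠ d
  connected : ∀ d d', ∃ s ∈ Subgroup.closure {next, twin}, s d = d'
  len_pos : ∀ d, 0 < len d
  len_twin : ∀ d, len (twin d) = len d
  len_lt : ∀ d, len d < len (next d) + len (next (next d))

namespace TriangulatedSurface

variable {D : Type*} (T : TriangulatedSurface D)

/-! ### Vertices, edges, faces, genus -/

/-- The counterclockwise rotation about the tail: it sends an oriented edge `d` to the next oriented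
edge with the same tail, namely the reversal of the side preceding `d` in the triangle of `d`. -/
def rot : Equiv.Perm D := T.next.symm.trans T.twin

/-- Vertices: the cycles of the rotation, an oriented edge representing its tail. -/
def Vertex : Type _ := Quotient (Equiv.Perm.SameCycle.setoid T.rot)

/-- Edges: pairs of mutually reversed oriented edges. -/
def Edge : Type _ := Quotient (Equiv.Perm.SameCycle.setoid T.twin)

/-- Faces: cycles of `next`, that is, triples of consecutive sides of a triangle. -/
def Face : Type _ := Quotient (Equiv.Perm.SameCycle.setoid T.next)

/-- The tail of an oriented edge. -/
def tail (d : D) : T.Vertex := Quotient.mk (Equiv.Perm.SameCycle.setoid T.rot) d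

/-- The head of an oriented edge. -/
def head (d : D) : T.Vertex := T.tail (T.twin d)

/-- The left shore of an oriented edge. -/
def left (d : D) : T.Face := Quotient.mk (Equiv.Perm.SameCycle.setoid T.next) d

/-- The genus is `g`, that is, the Euler characteristic is `2 - 2 * g`. -/
def HasGenus (g : ℕ) : Prop :=
  (Nat.card T.Vertex : ℤ) - Nat.card T.Edge + Nat.card T.Face = 2 - 2 * g

/-! ### Cotangent weights -/

/-- The angle opposite to the side `d` in the triangle to the left of `d` (law of cosines). -/
noncomputable def angle (d : D) : ℝ :=
  Real.arccos ((T.len (T.next d) ^ 2 + T.len (T.next (T.next d)) ^ 2 - T.len d ^ 2) /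
    (2 * T.len (T.next d) * T.len (T.next (T.next d))))

/-- The cotangent weight of an edge. -/
noncomputable def weight (d : D) : ℝ :=
  1 / 2 * Real.cot (T.angle d) + 1 / 2 * Real.cot (T.angle (T.twin d))

/-! ### Edge paths and their homotopy -/

/-- Arrows of this quiver are the oriented edges; edge paths are its `Quiver.Path`s. -/
instance quiver : Quiver T.Vertex where
  Hom v w := {d : D // T.tail d = v ∧ T.head d = w}

theorem head_twin (d : D) : T.head (T.twin d) = T.tail d := by
  simp [head, T.twin_twin]

instance hasReverse : Quiver.HasInvolutiveReverse T.Vertex where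
  reverse' := fun e => ⟨T.twin e.1, e.2.2, (T.head_twin e.1).trans e.2.1⟩
  inv' := fun e => Subtype.ext (T.twin_twin e.1)

/-- An oriented edge as an arrow. -/
def arrow (d : D) : T.tail d ⟶ T.head d := ⟨d, rfl, rfl⟩

/-- `T.Sweep p q n`: there is a homotopy with fixed endpoints from the edge path `p` to the edge
path `q` which sweeps each face `f` algebraically `n f` times. Homotopies are generated by inserting
or deleting a backtracking `e e⁻¹` (nothing is swept) and the boundary of a face (the face is swept
once, positively when its boundary is traversed counterclockwise). In particular `T.Sweep p nil n`
says that the closed path `p` is the counterclockwise boundary of a singular disc covering each face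
`f` with algebraic multiplicity `n f`. -/
inductive Sweep : {v w : T.Vertex} → Quiver.Path v w → Quiver.Path v w → (T.Face → ℤ) → Prop
  | refl {v w : T.Vertex} (p : Quiver.Path v w) : Sweep p p 0
  | symm {v w : T.Vertex} {p q : Quiver.Path v w} {n : T.Face → ℤ} :
      Sweep p q n → Sweep q p (-n)
  | trans {v w : T.Vertex} {p q r : Quiver.Path v w} {n m : T.Face → ℤ} :
      Sweep p q n → Sweep q r m → Sweep p r (n + m)
  | comp {v w x : T.Vertex} {p p' : Quiver.Path v w} {q q' : Quiver.Path w x}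
      {n m : T.Face → ℤ} :
      Sweep p p' n → Sweep q q' m → Sweep (p.comp q) (p'.comp q') (n + m)
  | backtrack {v w : T.Vertex} (e : v ⟶ w) :
      Sweep (e.toPath.comp (Quiver.reverse e).toPath) Quiver.Path.nil 0
  | face {v w x : T.Vertex} (e₁ : v ⟶ w) (e₂ : w ⟶ x) (e₃ : x ⟶ v)
      (h₂ : e₂.1 = T.next e₁.1) (h₃ : e₃.1 = T.next e₂.1) :
      Sweep ((e₁.toPath.comp e₂.toPath).comp e₃.toPath) Quiver.Path.nil
        (Set.indicator {T.left e₁.1} 1)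

/-- Homotopy of edge paths with fixed endpoints. -/
def homotopic (v w : T.Vertex) : Setoid (Quiver.Path v w) where
  r p q := ∃ n, T.Sweep p q n
  iseqv := ⟨fun p => ⟨0, .refl p⟩, fun h => h.elim fun n hn => ⟨-n, hn.symm⟩,
    fun h h' => h.elim fun n hn => h'.elim fun m hm => ⟨n + m, hn.trans hm⟩⟩

/-- Homotopy classes of edge paths from `v` to `w`. -/
def PathClass (v w : T.Vertex) : Type _ := Quotient (T.homotopic v w)

variable {T}

/-- The homotopy class of an edge path. -/
def cls {v w : T.Vertex} (p : Quiver.Path v w) : T.PathClass v w :=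
  Quotient.mk (T.homotopic v w) p

/-- Concatenation of homotopy classes: first `c`, then `c'`. -/
def PathClass.comp {v w x : T.Vertex} (c : T.PathClass v w) (c' : T.PathClass w x) :
    T.PathClass v x :=
  Quotient.map₂ (sa := T.homotopic v w) (sb := T.homotopic w x) (sc := T.homotopic v x)
    Quiver.Path.comp (fun _ _ h _ _ h' => h.elim fun n hn => h'.elim fun m hm =>
      ⟨n + m, hn.comp hm⟩) c c'

theorem PathClass.comp_assoc {v w x y : T.Vertex} (a : T.PathClass v w) (b : T.PathClass w x)
    (c : T.PathClass x y) : (a.comp b).comp c = a.comp (b.comp c) := by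
  induction a using Quotient.ind
  induction b using Quotient.ind
  induction c using Quotient.ind
  exact congrArg cls (Quiver.Path.comp_assoc _ _ _)

theorem Sweep.comp_reverse {v w : T.Vertex} (p : Quiver.Path v w) :
    T.Sweep (p.comp p.reverse) Quiver.Path.nil 0 := by
  induction p with
  | nil => exact .refl _
  | cons p e ih =>
    have h := ((Sweep.refl p).comp (Sweep.backtrack e)).comp (Sweep.refl p.reverse)
    simp only [Quiver.Path.comp_nil, add_zero] at h
    have h' := h.trans ih
    rw [add_zero] at h'
    convert h' using 1
    simp [Quiver.Path.reverse, Quiver.Hom.toPath, ← Quiver.Path.comp_assoc]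

theorem Sweep.reverse_comp {v w : T.Vertex} (p : Quiver.Path v w) :
    T.Sweep (p.reverse.comp p) Quiver.Path.nil 0 := by
  simpa using Sweep.comp_reverse p.reverse

/-- Homotopic paths have homotopic reversals. -/
theorem Sweep.reverse {v w : T.Vertex} {p q : Quiver.Path v w} {n : T.Face → ℤ}
    (h : T.Sweep p q n) : T.Sweep p.reverse q.reverse (-n) := by
  have h₁ := ((Sweep.refl p.reverse).comp (Sweep.comp_reverse q)).symm
  have h₂ := ((Sweep.refl p.reverse).comp h.symm).comp (Sweep.refl q.reverse)
  have h₃ := (Sweep.reverse_comp p).comp (Sweep.refl q.reverse)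
  simp only [Quiver.Path.comp_nil, Quiver.Path.nil_comp, Quiver.Path.comp_assoc, add_zero,
    zero_add, neg_zero] at h₁ h₂ h₃
  have h₄ := (h₁.trans h₂).trans h₃
  have e : (0 : T.Face → ℤ) + -n + 0 = -n := by rw [zero_add, add_zero]
  exact e ▸ h₄

/-- The fundamental group (of edge loops) at the vertex `z`; in `a * b` the loop `a` comes first. -/
instance PathClass.group (z : T.Vertex) : Group (T.PathClass z z) where
  mul := PathClass.comp
  one := cls Quiver.Path.nil
  inv := Quotient.map Quiver.Path.reverse fun _ _ ⟨n, h⟩ => ⟨-n, h.reverse⟩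
  mul_assoc := PathClass.comp_assoc
  one_mul a := by
    induction a using Quotient.ind
    exact congrArg cls (Quiver.Path.nil_comp _)
  mul_one a := by
    induction a using Quotient.ind
    rfl
  inv_mul_cancel a := by
    induction a using Quotient.ind
    exact Quotient.sound ⟨0, Sweep.reverse_comp _⟩

/-- The closed path `α₁β₁α₁⁻¹β₁⁻¹ … α_gβ_gα_g⁻¹β_g⁻¹`. -/
def commutatorPath {z : T.Vertex} {g : ℕ} (α β : Fin g → Quiver.Path z z) : Quiver.Path z z :=
  (List.ofFn fun k =>
    (((α k).comp (β k)).comp (α k).reverse).comp (β k).reverse).foldr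
      Quiver.Path.comp Quiver.Path.nil

/-- The closed paths `α₁, …, α_g, β₁, …, β_g` form a standard basis of the fundamental group: they
generate it, the closed path `α₁β₁α₁⁻¹β₁⁻¹ … α_gβ_gα_g⁻¹β_g⁻¹` is null-homotopic, and the basis is
compatible with the orientation of the surface: the `4g`-gon with this (counterclockwise) boundary
path is mapped to the surface with positive degree (the degree is then automatically one). -/
structure IsStandardBasis {z : T.Vertex} {g : ℕ} (α β : Fin g → Quiver.Path z z) : Prop where
  generate : Subgroup.closure
    (Set.range (fun k => cls (α k)) ∪ Set.range (fun k => cls (β k))) = ⊤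
  bounds : ∃ n : T.Face → ℤ,
    T.Sweep (commutatorPath α β) Quiver.Path.nil n ∧ ∀ f, 0 < n f

/-! ### The universal covering with base point over `z` -/

/-- Vertices of the universal covering: a vertex over `w` is a homotopy class of paths from the
projection `z` of the base point to `w`. -/
def CoverVertex (z : T.Vertex) : Type _ := Σ w : T.Vertex, T.PathClass z w

/-- Oriented edges of the universal covering: an oriented edge of the surface together with
a point of the covering over its tail. -/
def CoverDart (z : T.Vertex) : Type _ := Σ d : D, T.PathClass z (T.tail d)

namespace CoverDart

variable {z : T.Vertex}

/-- The tail of an oriented edge of the universal covering. -/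
def tail (e : CoverDart z) : CoverVertex z := ⟨T.tail e.1, e.2⟩

/-- The head of an oriented edge of the universal covering. -/
def head (e : CoverDart z) : CoverVertex z :=
  ⟨T.head e.1, e.2.comp (cls (T.arrow e.1).toPath)⟩

/-- The reversal of an oriented edge of the universal covering. -/
def twin (e : CoverDart z) : CoverDart z :=
  ⟨T.twin e.1, e.2.comp (cls (T.arrow e.1).toPath)⟩

/-- `e'` follows `e` on the boundary of a face of the universal covering. -/
def Follows (e e' : CoverDart z) : Prop := e'.1 = T.next e.1 ∧ e'.tail = e.head

end CoverDart

/-- Faces of the universal covering: a face is the class of the consecutive sides of its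
boundary. -/
def CoverFace (z : T.Vertex) : Type _ := Quot (CoverDart.Follows (z := z))

/-- The left shore of an oriented edge of the universal covering. -/
def CoverDart.left {z : T.Vertex} (e : CoverDart z) : CoverFace z :=
  Quot.mk CoverDart.Follows e

/-- The right shore of an oriented edge of the universal covering. -/
def CoverDart.right {z : T.Vertex} (e : CoverDart z) : CoverFace z := e.twin.left

/-- The deck transformation of a closed path, on the vertices of the universal covering. It sends
the base point (the class of the constant path) to the endpoint of the lift of the path. -/
def deckVertex {z : T.Vertex} (α : Quiver.Path z z) (x : CoverVertex z) : CoverVertex z :=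
  ⟨x.1, (cls α).comp x.2⟩

/-- The deck transformation of a closed path, on the oriented edges of the universal covering. -/
def deckDart {z : T.Vertex} (α : Quiver.Path z z) (e : CoverDart z) : CoverDart z :=
  ⟨e.1, (cls α).comp e.2⟩

/-- The deck transformation of a closed path, on the faces of the universal covering. -/
def deckFace {z : T.Vertex} (α : Quiver.Path z z) : CoverFace z → CoverFace z :=
  Quot.map (deckDart α) fun e e' h => by
    refine ⟨h.1, ?_⟩
    have h' : deckVertex α e'.tail = deckVertex α e.head := congrArg (deckVertex α) h.2
    refine Eq.trans h' ?_
    simp only [deckVertex, CoverDart.head, deckDart, PathClass.comp_assoc]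
    rfl

/-! ### Discrete Abelian integrals and period matrices -/

/-- A pair consisting of a real function on the vertices and a real function on the faces of the
universal covering. -/
structure CoverFunction (z : T.Vertex) where
  re : CoverVertex z → ℝ
  im : CoverFace z → ℝ

namespace CoverFunction

variable {z : T.Vertex} {g : ℕ}

/-- The pair is a discrete analytic function (on the universal covering). -/
def IsAnalytic (f : CoverFunction z) : Prop :=
  ∀ e : CoverDart z, f.im e.left - f.im e.right = T.weight e.1 * (f.re e.head - f.re e.tail)

/-- The pair is a multi-valued function with periods `A₁, …, A_g, B₁, …, B_g`. -/
structure HasPeriods (f : CoverFunction z) (α β : Fin g → Quiver.Path z z) (A B : Fin g → ℂ) :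
    Prop where
  re_α : ∀ k x, f.re (deckVertex (α k) x) - f.re x = (A k).re
  re_β : ∀ k x, f.re (deckVertex (β k) x) - f.re x = (B k).re
  im_α : ∀ k w, f.im (deckFace (α k) w) - f.im w = (A k).im
  im_β : ∀ k w, f.im (deckFace (β k) w) - f.im w = (B k).im

/-- The pair is a discrete Abelian integral of the 1st kind with periods
`A₁, …, A_g, B₁, …, B_g`. -/
def IsAbelianIntegral (f : CoverFunction z) (α β : Fin g → Quiver.Path z z) (A B : Fin g → ℂ) :
    Prop :=
  f.IsAnalytic ∧ f.HasPeriods α β A B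

end CoverFunction

/-- `P` is the period matrix: its `l`-th column consists of the B-periods of a discrete Abelian
integral of the 1st kind with A-periods `A_k = δ_{kl}`. -/
def IsPeriodMatrix {z : T.Vertex} {g : ℕ} (α β : Fin g → Quiver.Path z z)
    (P : Matrix (Fin g) (Fin g) ℂ) : Prop :=
  ∀ l, ∃ f : CoverFunction z, ∃ B : Fin g → ℂ,
    f.IsAbelianIntegral α β (fun k => if k = l then 1 else 0) B ∧ ∀ k, P k l = B k

/-- `P` is the dual period matrix: its `l`-th column consists of the B-periods, divided by `i`, of
a discrete Abelian integral of the 1st kind with A-periods `A_k = i δ_{kl}`. -/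
def IsDualPeriodMatrix {z : T.Vertex} {g : ℕ} (α β : Fin g → Quiver.Path z z)
    (P : Matrix (Fin g) (Fin g) ℂ) : Prop :=
  ∀ l, ∃ f : CoverFunction z, ∃ B : Fin g → ℂ,
    f.IsAbelianIntegral α β (fun k => if k = l then Complex.I else 0) B ∧
      ∀ k, P k l = B k / Complex.I

end TriangulatedSurface

/-! The proof transfers Riemann's bilinear relations to the surface. Let `φ` be the differences of
Re f. Choose a vertex function `v` on the universal covering with the periods of Im f, and put `κ d
= v (tail d) - Im f (left d)`. Deck transformations leave `φ` and `κ` unchanged, so both live on the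
finite surface, and `T.diff κ` is the differential of `v`. The discrete Cauchy–Riemann equation
becomes `weight d * φ d = κ (twin d) - κ (next d)`. Pairs `(φ, κ)` of this kind form the space
`harmonicPairs`. Integration turns each pair into an Abelian integral, and every integral has the
same periods as some pair.

Bilinear relation (`IsStandardBasis.exists_bilinear`): the iterated sum of `φ` and `T.diff κ` is
computed twice along the product of commutators. Algebraically it is the usual expression in A- and
B-periods. By a Stokes formula (`Sweep.iterSum_sub`) it is also a sum over the faces swept by the
null-homotopy. The boundary word is homologous to zero, so all faces are swept equally often, and
the orientation hypothesis makes this multiplicity positive. The face sum is then a positive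
multiple of the Dirichlet product.

Positivity (`energy_nonneg`, `eq_zero_of_energy_eq_zero`): cotangent weights may be negative, but
regrouped by faces the energy is a sum of Dirichlet energies of linear functions on nondegenerate
triangles.

If all complex A-periods vanish, so does the energy, hence `φ`, hence the B-periods; this is
uniqueness. Existence is linear algebra: the system for the pairs is injective, and Euler's formula
makes it square. The bilinear relation on the normalized bases identifies both imaginary parts with
Gram matrices; symmetry of the energy relates the real parts. -/

namespace TriangulatedSurface

/-! ### Sums and iterated sums along edge paths -/

section PathSum

variable {D : Type*} {T : TriangulatedSurface D}

/-- The sum of a function on oriented edges along an edge path. -/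
def pathSum (φ : D → ℝ) {v w : T.Vertex} : Quiver.Path v w → ℝ
  | .nil => 0
  | .cons p e => pathSum φ p + φ e.1

/-- The iterated sum (by the trapezoidal rule) of two functions on oriented edges along an
edge path. -/
noncomputable def iterSum (φ ψ : D → ℝ) {v w : T.Vertex} : Quiver.Path v w → ℝ
  | .nil => 0
  | .cons p e => iterSum φ ψ p + (pathSum φ p + φ e.1 / 2) * ψ e.1

@[simp] theorem pathSum_nil (φ : D → ℝ) (v : T.Vertex) :
    pathSum φ (Quiver.Path.nil : Quiver.Path v v) = 0 := rfl

@[simp] theorem pathSum_cons (φ : D → ℝ) {u v w : T.Vertex} (p : Quiver.Path u v) (e : v ⟶ w) :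
    pathSum φ (p.cons e) = pathSum φ p + φ e.1 := rfl

@[simp] theorem pathSum_toPath (φ : D → ℝ) {v w : T.Vertex} (e : v ⟶ w) :
    pathSum φ e.toPath = φ e.1 := zero_add _

@[simp] theorem pathSum_comp (φ : D → ℝ) {u v w : T.Vertex} (p : Quiver.Path u v)
    (q : Quiver.Path v w) : pathSum φ (p.comp q) = pathSum φ p + pathSum φ q := by
  induction q with
  | nil => simp
  | cons q e ih => simp [ih, add_assoc]

theorem pathSum_add (φ ψ : D → ℝ) {v w : T.Vertex} (p : Quiver.Path v w) :
    pathSum (φ + ψ) p = pathSum φ p + pathSum ψ p := by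
  induction p with
  | nil => simp
  | cons p e ih => simp [ih]; ring

theorem pathSum_smul (c : ℝ) (φ : D → ℝ) {v w : T.Vertex} (p : Quiver.Path v w) :
    pathSum (c • φ) p = c * pathSum φ p := by
  induction p with
  | nil => simp
  | cons p e ih => simp [ih]; ring

/-- The sum along an edge path, as a linear map. -/
def pathSumₗ {v w : T.Vertex} (p : Quiver.Path v w) : (D → ℝ) →ₗ[ℝ] ℝ where
  toFun φ := pathSum φ p
  map_add' φ ψ := pathSum_add φ ψ p
  map_smul' c φ := pathSum_smul c φ p

@[simp] theorem iterSum_nil (φ ψ : D → ℝ) (v : T.Vertex) :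
    iterSum φ ψ (Quiver.Path.nil : Quiver.Path v v) = 0 := rfl

@[simp] theorem iterSum_cons (φ ψ : D → ℝ) {u v w : T.Vertex} (p : Quiver.Path u v)
    (e : v ⟶ w) :
    iterSum φ ψ (p.cons e) = iterSum φ ψ p + (pathSum φ p + φ e.1 / 2) * ψ e.1 := rfl

@[simp] theorem iterSum_toPath (φ ψ : D → ℝ) {v w : T.Vertex} (e : v ⟶ w) :
    iterSum φ ψ e.toPath = φ e.1 * ψ e.1 / 2 := by
  change 0 + (0 + φ e.1 / 2) * ψ e.1 = _
  ring

-- Along `q` the inner sum starts from `pathSum φ p` instead of zero, which produces the product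
-- term.
@[simp] theorem iterSum_comp (φ ψ : D → ℝ) {u v w : T.Vertex} (p : Quiver.Path u v)
    (q : Quiver.Path v w) : iterSum φ ψ (p.comp q) =
      iterSum φ ψ p + iterSum φ ψ q + pathSum φ p * pathSum ψ q := by
  induction q with
  | nil => simp
  | cons q e ih => simp [ih]; ring

end PathSum

/-! ### Discrete forms and Stokes formulas for homotopies -/

section Forms

variable {D : Type*} (T : TriangulatedSurface D)

/-- Discrete 1-forms: functions that change sign when an oriented edge is reversed. -/
def IsForm (φ : D → ℝ) : Prop := ∀ d, φ (T.twin d) = -φ d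

/-- Functions on oriented edges with zero sum around each face. -/
def IsClosed (φ : D → ℝ) : Prop := ∀ d, φ d + φ (T.next d) + φ (T.next (T.next d)) = 0

/-- The differences of a function along the sides of the faces. -/
def diff (κ : D → ℝ) : D → ℝ := fun d => κ (T.next d) - κ d

theorem isClosed_diff (κ : D → ℝ) : T.IsClosed (T.diff κ) := fun d => by
  simp [diff, T.next_next_next]

theorem next_next_ne (d : D) : T.next (T.next d) ≠ d := fun h =>
  T.next_ne d ((congrArg T.next h).symm.trans (T.next_next_next d))

theorem left_next (d : D) : T.left (T.next d) = T.left d :=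
  Quotient.sound (s := Equiv.Perm.SameCycle.setoid T.next) ⟨-1, by simp⟩

theorem tail_next (d : D) : T.tail (T.next d) = T.head d :=
  Quotient.sound (s := Equiv.Perm.SameCycle.setoid T.rot) ⟨1, by simp [rot]⟩

theorem head_next_next (d : D) : T.head (T.next (T.next d)) = T.tail d := by
  rw [← tail_next, T.next_next_next]

theorem eq_or_eq_of_left_eq {d d' : D} (h : T.left d' = T.left d) :
    d' = d ∨ d' = T.next d ∨ d' = T.next (T.next d) := by
  obtain ⟨i, hi⟩ := (Quotient.exact (s := Equiv.Perm.SameCycle.setoid T.next) h).symm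
  have h3 : T.next ^ (3 : ℤ) = 1 := by
    ext x
    exact T.next_next_next x
  have hi' : (T.next ^ (i % 3)) d = d' := by
    rw [← hi]
    conv_rhs => rw [← Int.emod_add_mul_ediv i 3, zpow_add, zpow_mul, h3, one_zpow, mul_one]
  have h0 := Int.emod_nonneg i (by norm_num : (3 : ℤ) ≠ 0)
  have h1 := Int.emod_lt_of_pos i (by norm_num : (0 : ℤ) < 3)
  generalize i % 3 = j at *
  interval_cases j
  · exact .inl (by simpa using hi'.symm)
  · exact .inr (.inl (by simpa using hi'.symm))
  · exact .inr (.inr hi'.symm)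

theorem left_eq_iff {d d' : D} :
    T.left d' = T.left d ↔ d' = d ∨ d' = T.next d ∨ d' = T.next (T.next d) := by
  refine ⟨T.eq_or_eq_of_left_eq, ?_⟩
  rintro (rfl | rfl | rfl) <;> simp [left_next]

theorem sum_indicator_left [Fintype D] (d : D) (φ : D → ℝ) :
    ∑ d', ((Set.indicator {T.left d} 1 : T.Face → ℤ) (T.left d') : ℝ) * φ d' =
      φ d + φ (T.next d) + φ (T.next (T.next d)) := by
  classical
  have h : ∀ d', ((Set.indicator {T.left d} 1 : T.Face → ℤ) (T.left d') : ℝ) * φ d' =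
      if d' ∈ ({d, T.next d, T.next (T.next d)} : Finset D) then φ d' else 0 := by
    intro d'
    simp only [Set.indicator_apply, Set.mem_singleton_iff, left_eq_iff, Finset.mem_insert,
      Finset.mem_singleton]
    split_ifs <;> simp
  rw [Finset.sum_congr rfl fun d' _ => h d', Finset.sum_ite_mem, Finset.univ_inter,
    Finset.sum_insert, Finset.sum_pair, add_assoc]
  · exact (T.next_ne _).symm
  · simp [(T.next_ne d).symm, (T.next_next_ne d).symm]

variable {T}

theorem reverse_val {v w : T.Vertex} (e : v ⟶ w) : (Quiver.reverse e).1 = T.twin e.1 := rfl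

theorem pathSum_reverse {φ : D → ℝ} (hφ : T.IsForm φ) {v w : T.Vertex} (p : Quiver.Path v w) :
    pathSum φ p.reverse = -pathSum φ p := by
  induction p with
  | nil => simp
  | cons p e ih =>
    simp only [Quiver.Path.reverse, pathSum_comp, pathSum_toPath, ih, pathSum_cons, reverse_val,
      hφ e.1]
    ring

/-- Stokes' formula. Closedness is not assumed, so that test forms can detect the multiplicities
`n`. -/
theorem Sweep.pathSum_sub [Fintype D] {φ : D → ℝ} (hφ : T.IsForm φ) {v w : T.Vertex}
    {p q : Quiver.Path v w} {n : T.Face → ℤ} (h : T.Sweep p q n) :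
    pathSum φ p - pathSum φ q = ∑ d, (n (T.left d) : ℝ) * φ d := by
  induction h with
  | refl => simp
  | symm _ ih => simp [← ih]
  | trans _ _ ih ih' =>
    simp only [Pi.add_apply, Int.cast_add, add_mul, Finset.sum_add_distrib, ← ih, ← ih']
    ring
  | comp _ _ ih ih' =>
    simp only [Pi.add_apply, Int.cast_add, add_mul, Finset.sum_add_distrib, ← ih, ← ih',
      pathSum_comp]
    ring
  | backtrack e => simp [reverse_val, hφ e.1]
  | face e₁ e₂ e₃ h₂ h₃ => rw [sum_indicator_left]; simp [h₂, h₃]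

theorem Sweep.pathSum_eq {φ : D → ℝ} (hφ : T.IsForm φ) (hφ' : T.IsClosed φ) {v w : T.Vertex}
    {p q : Quiver.Path v w} {n : T.Face → ℤ} (h : T.Sweep p q n) :
    pathSum φ p = pathSum φ q := by
  induction h with
  | refl => rfl
  | symm _ ih => exact ih.symm
  | trans _ _ ih ih' => exact ih.trans ih'
  | comp _ _ ih ih' => simp [ih, ih']
  | backtrack e => simp [reverse_val, hφ e.1]
  | face e₁ e₂ e₃ h₂ h₃ => simpa [h₂, h₃] using hφ' e₁.1

/-- Stokes' formula for the product of a primitive of `φ` with `T.diff κ`. Closedness of both forms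
keeps the product terms of composed paths unchanged under homotopy. -/
theorem Sweep.iterSum_sub [Fintype D] {φ κ : D → ℝ} (hφ : T.IsForm φ) (hφ' : T.IsClosed φ)
    (hκ : T.IsForm (T.diff κ)) {v w : T.Vertex}
    {p q : Quiver.Path v w} {n : T.Face → ℤ} (h : T.Sweep p q n) :
    iterSum φ (T.diff κ) p - iterSum φ (T.diff κ) q =
      ∑ d, (n (T.left d) : ℝ) * (φ d * κ (T.next (T.next d)) / 2) := by
  induction h with
  | refl => simp
  | symm _ ih => simp [← ih]
  | trans _ _ ih ih' =>
    simp only [Pi.add_apply, Int.cast_add, add_mul, Finset.sum_add_distrib, ← ih, ← ih']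
    ring
  | comp h h' ih ih' =>
    simp only [Pi.add_apply, Int.cast_add, add_mul, Finset.sum_add_distrib,
      ← ih, ← ih', iterSum_comp, h.pathSum_eq hφ hφ', h'.pathSum_eq hκ (T.isClosed_diff κ)]
    ring
  -- The trapezoidal rule is needed here: the two halves `φψ/2` cancel the product term `-φψ`.
  | backtrack e =>
    simp only [iterSum_comp, iterSum_toPath, reverse_val, hφ e.1, hκ e.1, pathSum_toPath]
    simp
  | face e₁ e₂ e₃ h₂ h₃ =>
    rw [sum_indicator_left]
    have h := hφ' e₁.1
    simp only [iterSum_comp, iterSum_toPath, pathSum_comp, pathSum_toPath, iterSum_nil, h₂, h₃,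
      diff, T.next_next_next]
    rw [show φ (T.next (T.next e₁.1)) = - φ e₁.1 - φ (T.next e₁.1) by linarith]
    ring

theorem iterSum_commutator [Fintype D] {φ κ : D → ℝ} (hφ : T.IsForm φ) (hφ' : T.IsClosed φ)
    (hκ : T.IsForm (T.diff κ)) {z : T.Vertex} (a b : Quiver.Path z z) :
    iterSum φ (T.diff κ) (((a.comp b).comp a.reverse).comp b.reverse) =
      pathSum φ a * pathSum (T.diff κ) b - pathSum φ b * pathSum (T.diff κ) a := by
  -- Backtracking along `c` sweeps nothing, so the iterated sum along `c c⁻¹` is zero.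
  have key : ∀ c : Quiver.Path z z, iterSum φ (T.diff κ) c + iterSum φ (T.diff κ) c.reverse =
      pathSum φ c * pathSum (T.diff κ) c := fun c => by
    have h := (Sweep.comp_reverse c).iterSum_sub hφ hφ' hκ
    simp only [iterSum_comp, pathSum_reverse hκ, iterSum_nil, Pi.zero_apply, Int.cast_zero,
      zero_mul, Finset.sum_const_zero] at h
    linarith
  simp only [iterSum_comp, pathSum_comp, pathSum_reverse hκ, pathSum_reverse hφ]
  linear_combination key a + key b

theorem pathSum_foldr (φ : D → ℝ) {z : T.Vertex} (l : List (Quiver.Path z z)) :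
    pathSum φ (l.foldr Quiver.Path.comp Quiver.Path.nil) = (l.map (pathSum φ)).sum := by
  induction l with
  | nil => simp
  | cons p l ih => simp [ih]

/-- Each factor, like a commutator, has zero `φ`-sum, which kills all product terms. -/
theorem iterSum_foldr (φ ψ : D → ℝ) {z : T.Vertex} (l : List (Quiver.Path z z))
    (hl : ∀ p ∈ l, pathSum φ p = 0) :
    iterSum φ ψ (l.foldr Quiver.Path.comp Quiver.Path.nil) = (l.map (iterSum φ ψ)).sum := by
  induction l with
  | nil => simp
  | cons p l ih => simp [ih fun q hq => hl q (by simp [hq]), hl p (by simp)]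

theorem pathSum_commutatorPath {φ : D → ℝ} (hφ : T.IsForm φ) {z : T.Vertex} {g : ℕ}
    (α β : Fin g → Quiver.Path z z) : pathSum φ (commutatorPath α β) = 0 := by
  rw [commutatorPath, pathSum_foldr, List.map_ofFn, List.sum_ofFn]
  refine Finset.sum_eq_zero fun k _ => ?_
  simp [pathSum_reverse hφ]

theorem iterSum_commutatorPath [Fintype D] {φ κ : D → ℝ} (hφ : T.IsForm φ)
    (hφ' : T.IsClosed φ) (hκ : T.IsForm (T.diff κ)) {z : T.Vertex} {g : ℕ}
    (α β : Fin g → Quiver.Path z z) : iterSum φ (T.diff κ) (commutatorPath α β) =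
      ∑ k, (pathSum φ (α k) * pathSum (T.diff κ) (β k) -
        pathSum φ (β k) * pathSum (T.diff κ) (α k)) := by
  rw [commutatorPath, iterSum_foldr, List.map_ofFn, List.sum_ofFn]
  · exact Finset.sum_congr rfl fun k _ => iterSum_commutator hφ hφ' hκ _ _
  · intro p hp
    obtain ⟨k, rfl⟩ := List.mem_ofFn.1 hp
    simp [pathSum_reverse hφ]

/-- A property of oriented edges that is preserved by `next` and `twin` in both directions is
constant on a connected surface. -/
theorem iff_of_next_twin {P : D → Prop} (h₁ : ∀ d, P (T.next d) ↔ P d)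
    (h₂ : ∀ d, P (T.twin d) ↔ P d) (d d' : D) : P d' ↔ P d := by
  obtain ⟨s, hs, rfl⟩ := T.connected d d'
  induction hs using Subgroup.closure_induction generalizing d with
  | mem s hs =>
    rcases hs with rfl | rfl
    exacts [h₁ d, h₂ d]
  | one => rfl
  | mul s t _ _ ihs iht => exact (ihs (t d)).trans (iht d)
  | inv s _ ih => simpa using (ih (s⁻¹ d)).symm

/-- A singular disc whose boundary is homologous to zero covers all faces with the same
multiplicity. -/
theorem Sweep.multiplicity_eq [Fintype D] {v w : T.Vertex} {p q : Quiver.Path v w}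
    {n : T.Face → ℤ} (h : T.Sweep p q n)
    (hpq : ∀ φ, T.IsForm φ → pathSum φ p = pathSum φ q) (d d' : D) :
    n (T.left d') = n (T.left d) := by
  classical
  refine (iff_of_next_twin (T := T) (P := fun x => n (T.left x) = n (T.left d)) ?_ ?_ d d').2 rfl
  · intro x
    rw [left_next]
  · intro x
    -- Stokes' formula for this form compares the multiplicities on the two sides of the edge of
    -- `x`.
    have hφ : T.IsForm (Pi.single x 1 - Pi.single (T.twin x) 1) := fun y => by
      have h1 : T.twin y = x ↔ y = T.twin x :=
        ⟨fun h => by rw [← h, T.twin_twin], fun h => by rw [h, T.twin_twin]⟩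
      simp [Pi.single_apply, h1]
    have h := h.pathSum_sub hφ
    rw [hpq _ hφ, sub_self] at h
    simp only [Pi.sub_apply, mul_sub, Finset.sum_sub_distrib, Pi.single_apply, mul_ite, mul_one,
      mul_zero, Finset.sum_ite_eq', Finset.mem_univ, if_true] at h
    have h' : n (T.left x) = n (T.left (T.twin x)) := by exact_mod_cast (sub_eq_zero.1 h.symm)
    rw [h']

end Forms

/-! ### Harmonic pairs and the Riemann bilinear relation -/

section Harmonic

variable {D : Type*} (T : TriangulatedSurface D)

theorem weight_twin (d : D) : T.weight (T.twin d) = T.weight d := by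
  simp [weight, T.twin_twin, add_comm]

/-- Harmonic 1-forms `φ` together with a function `κ` on oriented edges such that `-κ` is a local
primitive of the conjugate form at each vertex, with matching differences along edges. -/
def harmonicPairs : Submodule ℝ ((D → ℝ) × (D → ℝ)) where
  carrier := {x | T.IsForm x.1 ∧ T.IsClosed x.1 ∧ T.IsForm (T.diff x.2) ∧
    ∀ d, T.weight d * x.1 d = x.2 (T.twin d) - x.2 (T.next d)}
  zero_mem' := by simp [IsForm, IsClosed, diff]
  add_mem' := by
    rintro x y ⟨h1, h2, h3, h4⟩ ⟨k1, k2, k3, k4⟩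
    refine ⟨fun d => ?_, fun d => ?_, fun d => ?_, fun d => ?_⟩
    · simp [h1 d, k1 d]; ring
    · have := h2 d; have := k2 d
      simp; linarith
    · have := h3 d; have := k3 d
      simp [diff] at *; linarith
    · have := h4 d; have := k4 d
      simp at *; linarith
  smul_mem' := by
    rintro c x ⟨h1, h2, h3, h4⟩
    refine ⟨fun d => ?_, fun d => ?_, fun d => ?_, fun d => ?_⟩
    · simp [h1 d]
    · have := h2 d
      simp; linear_combination c * this
    · have := h3 d
      simp [diff] at *; linear_combination c * this
    · have := h4 d
      simp at *; linear_combination c * this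

variable {T}

/-- Twice the sum over edges of the product of `φ` with the conjugate form. -/
theorem sum_mul_weight_mul [Fintype D] {φ : D → ℝ} (hφ : T.IsForm φ) (hφ' : T.IsClosed φ)
    {x : (D → ℝ) × (D → ℝ)} (hx : x ∈ T.harmonicPairs) :
    ∑ d, T.weight d * φ d * x.1 d = ∑ d, φ d * x.2 (T.next (T.next d)) := by
  have h1 : ∑ d, φ d * x.2 (T.twin d) = - ∑ d, φ d * x.2 d := by
    rw [← Equiv.sum_comp T.twin, ← Finset.sum_neg_distrib]
    exact Finset.sum_congr rfl fun d _ => by rw [hφ d, T.twin_twin, neg_mul]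
  have h2 : ∀ d, φ d * x.2 d + φ d * x.2 (T.next d) + φ d * x.2 (T.next (T.next d)) =
      φ d * (x.2 d + x.2 (T.next d) + x.2 (T.next (T.next d))) := fun d => by ring
  -- The bracket is constant on each face, where closed `φ` has zero sum; the factor 3 counts every
  -- face from each of its sides.
  have h3 : 3 * ∑ d, φ d * (x.2 d + x.2 (T.next d) + x.2 (T.next (T.next d))) = 0 := by
    set F : D → ℝ := fun d => φ d * (x.2 d + x.2 (T.next d) + x.2 (T.next (T.next d)))
    have e1 : ∑ d, F (T.next d) = ∑ d, F d := Equiv.sum_comp T.next F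
    have e2 : ∑ d, F (T.next (T.next d)) = ∑ d, F d := by
      rw [← e1, ← Equiv.sum_comp T.next fun d => F (T.next d)]
    calc 3 * ∑ d, F d = ∑ d, (F d + F (T.next d) + F (T.next (T.next d))) := by
          rw [Finset.sum_add_distrib, Finset.sum_add_distrib, e1, e2]; ring
      _ = 0 := Finset.sum_eq_zero fun d _ => by
          simp only [F, T.next_next_next]
          linear_combination (x.2 d + x.2 (T.next d) + x.2 (T.next (T.next d))) * hφ' d
  have h4 : ∑ d, T.weight d * φ d * x.1 d =
      ∑ d, φ d * x.2 (T.twin d) - ∑ d, φ d * x.2 (T.next d) := by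
    rw [← Finset.sum_sub_distrib]
    exact Finset.sum_congr rfl fun d _ => by linear_combination φ d * hx.2.2.2 d
  simp only [← h2, Finset.sum_add_distrib] at h3
  linarith

/-- The **Riemann bilinear relation**, up to a positive factor that depends on the basis only. -/
theorem IsStandardBasis.exists_bilinear [Fintype D] {z : T.Vertex} {g : ℕ}
    {α β : Fin g → Quiver.Path z z} (h : IsStandardBasis α β) :
    ∃ N : ℝ, 0 < N ∧ ∀ x ∈ T.harmonicPairs, ∀ y ∈ T.harmonicPairs,
      N * ∑ d, T.weight d * x.1 d * y.1 d = ∑ k,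
        (pathSum x.1 (α k) * pathSum (T.diff y.2) (β k) -
          pathSum x.1 (β k) * pathSum (T.diff y.2) (α k)) := by
  obtain ⟨n, hn, hpos⟩ := h.bounds
  obtain ⟨d₀, -⟩ := Quotient.exists_rep z
  -- Half the common multiplicity of the faces; the half comes from the right-hand side of
  -- `Sweep.iterSum_sub`.
  refine ⟨n (T.left d₀) / 2, by have := hpos (T.left d₀); positivity, fun x hx y hy => ?_⟩
  have h1 := hn.iterSum_sub hx.1 hx.2.1 hy.2.2.1
  rw [iterSum_commutatorPath hx.1 hx.2.1 hy.2.2.1, iterSum_nil, sub_zero] at h1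
  rw [h1, sum_mul_weight_mul hx.1 hx.2.1 hy, Finset.mul_sum]
  refine Finset.sum_congr rfl fun d _ => ?_
  rw [hn.multiplicity_eq (fun φ hφ => pathSum_commutatorPath hφ α β) d₀ d]
  ring

end Harmonic

/-! ### Euclidean triangles and their Dirichlet energy -/

section Positivity

/-- By Heron's formula this is the product of `a + b + c` and the three triangle excesses, sixteen
times the squared area. -/
theorem heron_pos {a b c : ℝ} (ha : 0 < a) (hab : a < b + c) (hbc : b < c + a)
    (hca : c < a + b) : 0 < 4 * b ^ 2 * c ^ 2 - (b ^ 2 + c ^ 2 - a ^ 2) ^ 2 := by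
  have h1 : 0 < b + c - a := by linarith
  have h2 : 0 < c + a - b := by linarith
  have h3 : 0 < a + b - c := by linarith
  have h4 : 0 < a + b + c := by linarith
  have h := mul_pos (mul_pos h1 h2) (mul_pos h3 h4)
  nlinarith only [h]

theorem cot_arccos_law_of_cosines {a b c : ℝ} (ha : 0 < a) (hb : 0 < b) (hc : 0 < c)
    (hab : a < b + c) (hbc : b < c + a) (hca : c < a + b) :
    Real.cot (Real.arccos ((b ^ 2 + c ^ 2 - a ^ 2) / (2 * b * c))) =
      (b ^ 2 + c ^ 2 - a ^ 2) / √(4 * b ^ 2 * c ^ 2 - (b ^ 2 + c ^ 2 - a ^ 2) ^ 2) := by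
  have hH := heron_pos ha hab hbc hca
  have h2 : (0 : ℝ) < 2 * b * c := by positivity
  have h1 : |b ^ 2 + c ^ 2 - a ^ 2| ≤ 2 * b * c :=
    abs_le_of_sq_le_sq (by rw [mul_pow, mul_pow]; linarith) h2.le
  have h3 : 1 - ((b ^ 2 + c ^ 2 - a ^ 2) / (2 * b * c)) ^ 2 =
      (4 * b ^ 2 * c ^ 2 - (b ^ 2 + c ^ 2 - a ^ 2) ^ 2) / (2 * b * c) ^ 2 := by
    field_simp
    ring
  rw [Real.cot_eq_cos_div_sin, Real.sin_arccos, h3, Real.sqrt_div hH.le, Real.sqrt_sq h2.le,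
    Real.cos_arccos, div_div_div_cancel_right₀ h2.ne']
  · rw [le_div_iff₀ h2]
    linarith [(abs_le.1 h1).1]
  · rw [div_le_one h2]
    exact (abs_le.1 h1).2

/-- The Dirichlet energy of a linear function on a nondegenerate triangle is nonnegative, and
positive unless the function is constant. -/
theorem triangle_energy {a b c x y t : ℝ} (ha : 0 < a)
    (hab : a < b + c) (hbc : b < c + a) (hca : c < a + b) (h : x + y + t = 0) :
    0 ≤ (b ^ 2 + c ^ 2 - a ^ 2) * x ^ 2 + (c ^ 2 + a ^ 2 - b ^ 2) * y ^ 2 +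
      (a ^ 2 + b ^ 2 - c ^ 2) * t ^ 2 ∧
    ((b ^ 2 + c ^ 2 - a ^ 2) * x ^ 2 + (c ^ 2 + a ^ 2 - b ^ 2) * y ^ 2 +
      (a ^ 2 + b ^ 2 - c ^ 2) * t ^ 2 = 0 → x = 0) := by
  have hH := heron_pos ha hab hbc hca
  obtain rfl : t = -x - y := by linarith
  -- Completing the square in `y`; the remaining coefficient of `x ^ 2` is Heron's expression.
  have key : 2 * a ^ 2 * ((b ^ 2 + c ^ 2 - a ^ 2) * x ^ 2 + (c ^ 2 + a ^ 2 - b ^ 2) * y ^ 2 +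
      (a ^ 2 + b ^ 2 - c ^ 2) * (-x - y) ^ 2) =
      (2 * a ^ 2 * y + (a ^ 2 + b ^ 2 - c ^ 2) * x) ^ 2 +
        (4 * b ^ 2 * c ^ 2 - (b ^ 2 + c ^ 2 - a ^ 2) ^ 2) * x ^ 2 := by ring
  have ha2 : 0 < 2 * a ^ 2 := by positivity
  constructor
  · have : 0 ≤ 2 * a ^ 2 * ((b ^ 2 + c ^ 2 - a ^ 2) * x ^ 2 + (c ^ 2 + a ^ 2 - b ^ 2) * y ^ 2 +
      (a ^ 2 + b ^ 2 - c ^ 2) * (-x - y) ^ 2) := by rw [key]; positivity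
    exact nonneg_of_mul_nonneg_right this ha2
  · intro h0
    rw [h0, mul_zero] at key
    by_contra hx
    have : 0 < (4 * b ^ 2 * c ^ 2 - (b ^ 2 + c ^ 2 - a ^ 2) ^ 2) * x ^ 2 := by positivity
    nlinarith [sq_nonneg (2 * a ^ 2 * y + (a ^ 2 + b ^ 2 - c ^ 2) * x)]

end Positivity

/-! ### Positivity of the Dirichlet energy on the surface -/

section Energy

variable {D : Type*} {T : TriangulatedSurface D}

/-- The area of the triangle to the left of an oriented edge, multiplied by four. -/
noncomputable def area (T : TriangulatedSurface D) (d : D) : ℝ :=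
  √(4 * T.len (T.next d) ^ 2 * T.len (T.next (T.next d)) ^ 2 -
    (T.len (T.next d) ^ 2 + T.len (T.next (T.next d)) ^ 2 - T.len d ^ 2) ^ 2)

theorem len_lt_next (d : D) :
    T.len (T.next d) < T.len (T.next (T.next d)) + T.len d := by
  simpa [T.next_next_next] using T.len_lt (T.next d)

theorem len_lt_next_next (d : D) :
    T.len (T.next (T.next d)) < T.len d + T.len (T.next d) := by
  simpa [T.next_next_next] using T.len_lt (T.next (T.next d))

theorem area_pos (d : D) : 0 < T.area d :=
  Real.sqrt_pos.2 (heron_pos (T.len_pos d) (T.len_lt d) (len_lt_next d) (len_lt_next_next d))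

theorem area_next (d : D) : T.area (T.next d) = T.area d := by
  unfold area
  congr 1
  rw [T.next_next_next]
  ring

theorem cot_angle (d : D) : Real.cot (T.angle d) =
    (T.len (T.next d) ^ 2 + T.len (T.next (T.next d)) ^ 2 - T.len d ^ 2) / T.area d :=
  cot_arccos_law_of_cosines (T.len_pos _) (T.len_pos _) (T.len_pos _) (T.len_lt d)
    (len_lt_next d) (len_lt_next_next d)

/-- All three cotangents have the same denominator `T.area d`, so `triangle_energy` applies to the
numerators. -/
theorem face_energy {φ : D → ℝ} (hφ : T.IsClosed φ) (d : D) :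
    0 ≤ Real.cot (T.angle d) * φ d ^ 2 + Real.cot (T.angle (T.next d)) * φ (T.next d) ^ 2 +
      Real.cot (T.angle (T.next (T.next d))) * φ (T.next (T.next d)) ^ 2 ∧
    (Real.cot (T.angle d) * φ d ^ 2 + Real.cot (T.angle (T.next d)) * φ (T.next d) ^ 2 +
      Real.cot (T.angle (T.next (T.next d))) * φ (T.next (T.next d)) ^ 2 = 0 → φ d = 0) := by
  have h := triangle_energy (T.len_pos d) (T.len_lt d) (len_lt_next d) (len_lt_next_next d) (hφ d)
  have hA := area_pos (T := T) d
  simp only [cot_angle, area_next, T.next_next_next]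
  simp only [div_mul_eq_mul_div, ← add_div]
  refine ⟨div_nonneg h.1 hA.le, fun h0 => h.2 ?_⟩
  exact (div_eq_zero_iff.1 h0).resolve_right hA.ne'

/-- Each weight splits into one half-cotangent per adjacent triangle. Regrouping by triangles counts
each of them once from each side, hence the 3. -/
theorem sum_weight_mul_sq [Fintype D] {φ : D → ℝ} (hφ : T.IsForm φ) :
    3 * ∑ d, T.weight d * φ d * φ d = ∑ d, (Real.cot (T.angle d) * φ d ^ 2 +
      Real.cot (T.angle (T.next d)) * φ (T.next d) ^ 2 +
      Real.cot (T.angle (T.next (T.next d))) * φ (T.next (T.next d)) ^ 2) := by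
  set F : D → ℝ := fun d => Real.cot (T.angle d) * φ d ^ 2
  have e1 : ∑ d, F (T.next d) = ∑ d, F d := Equiv.sum_comp T.next F
  have e2 : ∑ d, F (T.next (T.next d)) = ∑ d, F d := by
    rw [← e1, ← Equiv.sum_comp T.next fun d => F (T.next d)]
  have e3 : ∑ d, F (T.twin d) = ∑ d, F d := Equiv.sum_comp T.twin F
  have e4 : ∑ d, T.weight d * φ d * φ d = ∑ d, (F d / 2 + F (T.twin d) / 2) :=
    Finset.sum_congr rfl fun d _ => by
      simp only [weight, F, hφ d]
      ring
  rw [Finset.sum_add_distrib, Finset.sum_add_distrib, e4, Finset.sum_add_distrib,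
    ← Finset.sum_div, ← Finset.sum_div, e3, e1, e2]
  ring

/-- The Dirichlet energy of a closed discrete 1-form is nonnegative. -/
theorem energy_nonneg [Fintype D] {φ : D → ℝ} (hφ : T.IsForm φ) (hφ' : T.IsClosed φ) :
    0 ≤ ∑ d, T.weight d * φ d * φ d := by
  have h : 0 ≤ 3 * ∑ d, T.weight d * φ d * φ d := by
    rw [sum_weight_mul_sq hφ]
    exact Finset.sum_nonneg fun d _ => (face_energy hφ' d).1
  linarith

/-- A closed discrete 1-form of zero Dirichlet energy vanishes. -/
theorem eq_zero_of_energy_eq_zero [Fintype D] {φ : D → ℝ} (hφ : T.IsForm φ)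
    (hφ' : T.IsClosed φ) (h : ∑ d, T.weight d * φ d * φ d = 0) : φ = 0 := by
  have h3 := sum_weight_mul_sq hφ
  rw [h, mul_zero] at h3
  funext d
  exact (face_energy hφ' d).2
    ((Finset.sum_eq_zero_iff_of_nonneg fun d _ => (face_energy hφ' d).1).1 h3.symm d
      (Finset.mem_univ d))

end Energy

/-! ### Existence of harmonic pairs by a dimension count -/

section Existence

variable {D : Type*} {T : TriangulatedSurface D}

theorem diff_add (ψ κ : D → ℝ) : T.diff (ψ + κ) = T.diff ψ + T.diff κ := by
  funext d
  simp [diff]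
  ring

theorem diff_smul (c : ℝ) (ψ : D → ℝ) : T.diff (c • ψ) = c • T.diff ψ := by
  funext d
  simp [diff]
  ring

theorem sum_diff [Fintype D] (ψ : D → ℝ) : ∑ d, T.diff ψ d = 0 := by
  simp only [diff, Finset.sum_sub_distrib]
  rw [Equiv.sum_comp T.next ψ, sub_self]

instance [Finite D] : Finite T.Vertex :=
  inferInstanceAs (Finite (Quotient (Equiv.Perm.SameCycle.setoid T.rot)))

instance [Finite D] : Finite T.Edge :=
  inferInstanceAs (Finite (Quotient (Equiv.Perm.SameCycle.setoid T.twin)))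

instance [Finite D] : Finite T.Face :=
  inferInstanceAs (Finite (Quotient (Equiv.Perm.SameCycle.setoid T.next)))

/-- The edge underlying an oriented edge. -/
def edge (T : TriangulatedSurface D) (d : D) : T.Edge :=
  Quotient.mk (Equiv.Perm.SameCycle.setoid T.twin) d

/-- A chosen orientation of an edge. -/
noncomputable def orient (e : T.Edge) : D :=
  Quotient.out (s := Equiv.Perm.SameCycle.setoid T.twin) e

theorem edge_orient (e : T.Edge) : T.edge (orient e) = e :=
  Quotient.out_eq (s := Equiv.Perm.SameCycle.setoid T.twin) e

theorem edge_twin (d : D) : T.edge (T.twin d) = T.edge d :=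
  Quotient.sound (s := Equiv.Perm.SameCycle.setoid T.twin) ⟨-1, by simp⟩

theorem edge_eq_iff {d d' : D} : T.edge d' = T.edge d ↔ d' = d ∨ d' = T.twin d := by
  constructor
  · intro h
    obtain ⟨i, hi⟩ := (Quotient.exact (s := Equiv.Perm.SameCycle.setoid T.twin) h).symm
    have h2 : T.twin ^ (2 : ℤ) = 1 := by
      ext x
      exact T.twin_twin x
    have hi' : (T.twin ^ (i % 2)) d = d' := by
      rw [← hi]
      conv_rhs => rw [← Int.emod_add_mul_ediv i 2, zpow_add, zpow_mul, h2, one_zpow, mul_one]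
    rcases Int.emod_two_eq_zero_or_one i with h | h <;> rw [h] at hi'
    · exact .inl (by simpa using hi'.symm)
    · exact .inr (by simpa using hi'.symm)
  · rintro (rfl | rfl)
    exacts [rfl, edge_twin _]

theorem sum_orient_add_twin [Fintype D] [Fintype T.Edge] (F : D → ℝ) :
    ∑ e : T.Edge, (F (orient e) + F (T.twin (orient e))) = ∑ d, F d := by
  classical
  rw [← Finset.sum_fiberwise (s := Finset.univ) (g := T.edge) (f := F)]
  refine Finset.sum_congr rfl fun e _ => ?_
  have : (Finset.univ.filter fun d => T.edge d = e) = {orient e, T.twin (orient e)} := by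
    ext d
    conv_lhs => rw [← edge_orient e]
    simp [edge_eq_iff]
  rw [this, Finset.sum_pair (T.twin_ne _).symm]

theorem card_eq_two_mul_card_edge [Fintype D] [Fintype T.Edge] :
    Fintype.card D = 2 * Fintype.card T.Edge := by
  have h := sum_orient_add_twin (T := T) fun _ => (1 : ℝ)
  simp only [Finset.sum_const, Finset.card_univ, nsmul_eq_mul, mul_one] at h
  have : ((2 * Fintype.card T.Edge : ℕ) : ℝ) = (Fintype.card D : ℝ) := by
    rw [← h]
    push_cast
    ring
  exact_mod_cast this.symm

/-- Summed over all edges, the differences cancel and only `r` times the number of edges remains. -/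
theorem eq_zero_of_diff_add_diff_twin_add [Finite D] [Nonempty D] {χ : D → ℝ} {r : ℝ}
    (hr : ∀ e : T.Edge, T.diff χ (orient e) + T.diff χ (T.twin (orient e)) + r = 0) :
    r = 0 := by
  have := Fintype.ofFinite D
  have := Fintype.ofFinite T.Edge
  by_contra h0
  have h := Finset.sum_eq_zero (s := Finset.univ) fun e _ => hr e
  rw [Finset.sum_add_distrib, sum_orient_add_twin, sum_diff, zero_add, Finset.sum_const,
    Finset.card_univ, nsmul_eq_mul] at h
  have : Nonempty T.Edge := .map T.edge inferInstance
  exact mul_ne_zero (by exact_mod_cast Fintype.card_ne_zero) h0 h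

/-- One orientation per edge suffices: `h₂` makes the Cauchy–Riemann equation invariant under
reversal. -/
theorem diff_mem_harmonicPairs {ψ κ : D → ℝ}
    (h₁ : ∀ e : T.Edge, T.diff ψ (orient e) + T.diff ψ (T.twin (orient e)) = 0)
    (h₂ : ∀ e : T.Edge, T.diff κ (orient e) + T.diff κ (T.twin (orient e)) = 0)
    (h₃ : ∀ e : T.Edge, T.weight (orient e) * T.diff ψ (orient e) =
      κ (T.twin (orient e)) - κ (T.next (orient e))) : (T.diff ψ, κ) ∈ T.harmonicPairs := by
  have hd : ∀ d, ∃ e : T.Edge, d = orient e ∨ d = T.twin (orient e) := fun d =>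
    ⟨T.edge d, edge_eq_iff.1 (edge_orient _).symm⟩
  have hform : ∀ φ : D → ℝ, (∀ e : T.Edge, φ (orient e) + φ (T.twin (orient e)) = 0) →
      T.IsForm φ := fun φ h d => by
    obtain ⟨e, rfl | rfl⟩ := hd d
    · linarith [h e]
    · rw [T.twin_twin]
      linarith [h e]
  refine ⟨hform _ h₁, T.isClosed_diff ψ, hform _ h₂, fun d => ?_⟩
  obtain ⟨e, rfl | rfl⟩ := hd d
  · exact h₃ e
  · have := h₂ e
    simp only [diff] at this
    have h4 := hform _ h₁ (orient e)
    have h5 := h₃ e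
    simp only [weight_twin, T.twin_twin, h4]
    linarith

theorem apply_zpow_eq {σ : Equiv.Perm D} {χ : D → ℝ} (h : ∀ d, χ (σ d) = χ d) (i : ℤ) (d : D) :
    χ ((σ ^ i) d) = χ d := by
  induction i generalizing d with
  | zero => simp
  | succ i ih => rw [zpow_add_one, Equiv.Perm.mul_apply, ih, h]
  | pred i ih =>
    rw [zpow_sub_one, Equiv.Perm.mul_apply, ih, ← h (σ⁻¹ d)]
    simp

/-- A function that is constant on the cycles of a permutation and vanishes at a point of each
cycle is zero. -/
theorem eq_zero_of_apply_out_eq_zero {σ : Equiv.Perm D} {χ : D → ℝ} (h : ∀ d, χ (σ d) = χ d)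
    (hq : ∀ q, χ (Quotient.out (s := Equiv.Perm.SameCycle.setoid σ) q) = 0) : χ = 0 := by
  funext d
  obtain ⟨i, hi⟩ : Equiv.Perm.SameCycle σ
      (Quotient.out (s := Equiv.Perm.SameCycle.setoid σ) (Quotient.mk _ d)) d :=
    Quotient.exact (s := Equiv.Perm.SameCycle.setoid σ) (Quotient.out_eq _)
  rw [← hi, apply_zpow_eq h, hq]
  rfl

/-- A function on oriented edges that depends on the tail only has zero sums along closed
paths. -/
theorem pathSum_diff_eq_zero {κ : D → ℝ} (hκ : ∀ d, κ (T.rot d) = κ d) {z : T.Vertex}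
    (p : Quiver.Path z z) : pathSum (T.diff κ) p = 0 := by
  let F : T.Vertex → ℝ := Quotient.lift (s := Equiv.Perm.SameCycle.setoid T.rot) κ
    fun a b ⟨i, hi⟩ => by rw [← hi, apply_zpow_eq hκ]
  have hF : ∀ d, F (T.tail d) = κ d := fun d => rfl
  have key : ∀ {v w : T.Vertex} (q : Quiver.Path v w), pathSum (T.diff κ) q = F w - F v := by
    intro v w q
    induction q with
    | nil => simp
    | cons q e ih =>
      obtain ⟨d, rfl, rfl⟩ := e
      have hd : F (T.head d) = κ (T.next d) := by rw [← tail_next, hF]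
      rw [pathSum_cons, ih, hd, hF]
      simp [diff]
  rw [key, sub_self]

/-- With zero form, the Cauchy–Riemann equation at the preceding side of the triangle equates `κ` on
consecutive edges around a vertex. -/
theorem rot_eq_of_fst_eq_zero {x : (D → ℝ) × (D → ℝ)} (hx : x ∈ T.harmonicPairs)
    (h : x.1 = 0) (d : D) : x.2 (T.rot d) = x.2 d := by
  have := hx.2.2.2 (T.next.symm d)
  simp only [h, Pi.zero_apply, mul_zero, Equiv.apply_symm_apply] at this
  simp only [rot, Equiv.trans_apply]
  linarith

/-- Every term of the bilinear relation of `x` with itself contains an A-period, so the energy is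
zero. -/
theorem IsStandardBasis.fst_eq_zero [Fintype D] {z : T.Vertex} {g : ℕ}
    {α β : Fin g → Quiver.Path z z} (h : IsStandardBasis α β) {x : (D → ℝ) × (D → ℝ)}
    (hx : x ∈ T.harmonicPairs) (h₁ : ∀ k, pathSum x.1 (α k) = 0)
    (h₂ : ∀ k, pathSum (T.diff x.2) (α k) = 0) : x.1 = 0 := by
  obtain ⟨N, hN, hb⟩ := h.exists_bilinear
  have := hb x hx x hx
  simp only [h₁, h₂, zero_mul, mul_zero, sub_zero, Finset.sum_const_zero] at this
  exact eq_zero_of_energy_eq_zero hx.1 hx.2.1 ((mul_eq_zero.1 this).resolve_left hN.ne')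

/-- The equations of harmonic pairs, their A-periods, and a normalization. -/
noncomputable def harmonicSystem {z : T.Vertex} {g : ℕ} (α : Fin g → Quiver.Path z z) :
    ((D → ℝ) × (D → ℝ) × ℝ × ℝ) →ₗ[ℝ]
      ((T.Edge → ℝ) × (T.Edge → ℝ) × (T.Edge → ℝ) × (Fin g → ℝ) × (Fin g → ℝ) ×
        (T.Face → ℝ) × (T.Vertex → ℝ)) where
  toFun x :=
    -- Writing `φ = T.diff ψ` builds in closedness. The edge equations for `ψ`, and likewise for
    -- `κ`, have dependent left-hand sides (total zero); the two extra scalar unknowns compensate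
    -- for this and vanish on solutions.
    (fun e => T.diff x.1 (orient e) + T.diff x.1 (T.twin (orient e)) + x.2.2.1,
      fun e => T.diff x.2.1 (orient e) + T.diff x.2.1 (T.twin (orient e)) + x.2.2.2,
      fun e => T.weight (orient e) * T.diff x.1 (orient e) -
        (x.2.1 (T.twin (orient e)) - x.2.1 (T.next (orient e))),
      fun k => pathSum (T.diff x.1) (α k),
      fun k => pathSum (T.diff x.2.1) (α k),
      -- Normalization: `ψ` is free up to a constant on each face, `κ` up to a constant at each
      -- vertex.
      fun f => x.1 (Quotient.out (s := Equiv.Perm.SameCycle.setoid T.next) f),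
      fun v => x.2.1 (Quotient.out (s := Equiv.Perm.SameCycle.setoid T.rot) v))
  map_add' x y := by
    ext <;> simp [diff_add, pathSum_add] <;> ring
  map_smul' c x := by
    ext <;> simp [diff_smul, pathSum_smul] <;> ring

theorem IsStandardBasis.harmonicSystem_injective [Fintype D] {z : T.Vertex} {g : ℕ}
    {α β : Fin g → Quiver.Path z z} (h : IsStandardBasis α β) :
    Function.Injective (harmonicSystem α) := by
  have := Fintype.ofFinite T.Edge
  rw [injective_iff_map_eq_zero]
  rintro ⟨ψ, κ, s, t⟩ h0
  simp only [harmonicSystem, LinearMap.coe_mk, AddHom.coe_mk, Prod.mk_eq_zero, funext_iff,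
    Pi.zero_apply] at h0
  obtain ⟨h1, h2, h3, h4, h5, h6, h7⟩ := h0
  have : Nonempty D := (Quotient.exists_rep z).nonempty
  obtain rfl := eq_zero_of_diff_add_diff_twin_add h1
  obtain rfl := eq_zero_of_diff_add_diff_twin_add h2
  simp only [add_zero] at h1 h2
  have hx := diff_mem_harmonicPairs h1 h2 fun e => sub_eq_zero.1 (h3 e)
  have hψ : T.diff ψ = 0 := h.fst_eq_zero hx h4 h5
  have e1 : ψ = 0 := eq_zero_of_apply_out_eq_zero (σ := T.next)
    (fun d => sub_eq_zero.1 (congrFun hψ d)) h6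
  have e2 : κ = 0 := eq_zero_of_apply_out_eq_zero (rot_eq_of_fst_eq_zero hx hψ) h7
  simp [e1, e2]

/-- There are harmonic pairs with arbitrary A-periods. -/
theorem IsStandardBasis.exists_harmonicPair [Fintype D] {z : T.Vertex} {g : ℕ}
    (hT : T.HasGenus g) {α β : Fin g → Quiver.Path z z} (h : IsStandardBasis α β)
    (a b : Fin g → ℝ) : ∃ x ∈ T.harmonicPairs, (∀ k, pathSum x.1 (α k) = a k) ∧
      ∀ k, pathSum (T.diff x.2) (α k) = b k := by
  have := Fintype.ofFinite T.Edge
  have := Fintype.ofFinite T.Face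
  have := Fintype.ofFinite T.Vertex
  have hcard := card_eq_two_mul_card_edge (T := T)
  simp only [HasGenus, Nat.card_eq_fintype_card] at hT
  -- With `|D| = 2E`, the equality `4E + 2 = 3E + 2g + F + V` is Euler's formula.
  have hrank : Module.finrank ℝ ((D → ℝ) × (D → ℝ) × ℝ × ℝ) =
      Module.finrank ℝ ((T.Edge → ℝ) × (T.Edge → ℝ) × (T.Edge → ℝ) × (Fin g → ℝ) ×
        (Fin g → ℝ) × (T.Face → ℝ) × (T.Vertex → ℝ)) := by
    simp only [Module.finrank_prod, Module.finrank_fintype_fun_eq_card, Module.finrank_self,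
      Fintype.card_fin]
    omega
  obtain ⟨⟨ψ, κ, s, t⟩, hy⟩ := (LinearMap.injective_iff_surjective_of_finrank_eq_finrank hrank).1
    h.harmonicSystem_injective (0, 0, 0, a, b, 0, 0)
  simp only [harmonicSystem, LinearMap.coe_mk, AddHom.coe_mk, Prod.mk.injEq, funext_iff,
    Pi.zero_apply] at hy
  obtain ⟨h1, h2, h3, h4, h5, -, -⟩ := hy
  have : Nonempty D := (Quotient.exists_rep z).nonempty
  obtain rfl := eq_zero_of_diff_add_diff_twin_add h1
  obtain rfl := eq_zero_of_diff_add_diff_twin_add h2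
  simp only [add_zero] at h1 h2
  exact ⟨_, diff_mem_harmonicPairs h1 h2 fun e => sub_eq_zero.1 (h3 e), h4, h5⟩

end Existence

/-! ### From harmonic pairs to Abelian integrals -/

section Integration

variable {D : Type*} {T : TriangulatedSurface D} {z : T.Vertex} {g : ℕ}

/-- The integral of a closed discrete 1-form, as a function on the universal covering. -/
def primitive {φ : D → ℝ} (hφ : T.IsForm φ) (hφ' : T.IsClosed φ) (x : CoverVertex z) : ℝ :=
  Quotient.lift (s := T.homotopic z x.1) (pathSum φ)
    (fun _ _ ⟨_, hn⟩ => hn.pathSum_eq hφ hφ') x.2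

theorem primitive_comp {φ : D → ℝ} (hφ : T.IsForm φ) (hφ' : T.IsClosed φ) {v w : T.Vertex}
    (c : T.PathClass z v) (p : Quiver.Path v w) :
    primitive hφ hφ' ⟨w, c.comp (cls p)⟩ = primitive hφ hφ' ⟨v, c⟩ + pathSum φ p := by
  induction c using Quotient.ind
  exact pathSum_comp φ _ p

theorem primitive_deck {φ : D → ℝ} (hφ : T.IsForm φ) (hφ' : T.IsClosed φ)
    (a : Quiver.Path z z) (x : CoverVertex z) :
    primitive hφ hφ' (deckVertex a x) = primitive hφ hφ' x + pathSum φ a := by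
  obtain ⟨w, c⟩ := x
  induction c using Quotient.ind
  exact (pathSum_comp φ a _).trans (add_comm _ _)

/-- The discrete Abelian integral given by a harmonic pair. -/
def integral {x : (D → ℝ) × (D → ℝ)} (hx : x ∈ T.harmonicPairs) (z : T.Vertex) :
    CoverFunction z where
  re := primitive hx.1 hx.2.1
  -- Passing to the next side of a face changes the primitive and `κ` by the same amount `T.diff κ`.
  im := Quot.lift (fun e => primitive hx.2.2.1 (T.isClosed_diff x.2) e.tail - x.2 e.1)
    fun e e' h => by
      have h1 := primitive_comp hx.2.2.1 (T.isClosed_diff x.2) e.2 (T.arrow e.1).toPath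
      rw [h.2, h.1, CoverDart.head, h1, pathSum_toPath]
      simp only [arrow, diff, CoverDart.tail]
      ring

/-- The complex period of a harmonic pair along a closed path. -/
def period (x : (D → ℝ) × (D → ℝ)) (p : Quiver.Path z z) : ℂ :=
  ⟨pathSum x.1 p, pathSum (T.diff x.2) p⟩

theorem integral_isAbelianIntegral {x : (D → ℝ) × (D → ℝ)} (hx : x ∈ T.harmonicPairs)
    (α β : Fin g → Quiver.Path z z) : (integral hx z).IsAbelianIntegral α β
      (fun k => period x (α k)) (fun k => period x (β k)) := by
  have him : ∀ a w, (integral hx z).im (deckFace a w) - (integral hx z).im w =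
      pathSum (T.diff x.2) a := by
    intro a w
    induction w using Quot.ind
    rename_i e
    have h := primitive_deck hx.2.2.1 (T.isClosed_diff x.2) a e.tail
    change primitive _ _ (deckVertex a e.tail) - x.2 e.1 - (primitive _ _ e.tail - x.2 e.1) = _
    linarith
  refine ⟨fun e => ?_, ⟨fun k y => ?_, fun k y => ?_, fun k w => him _ w, fun k w => him _ w⟩⟩
  · have h1 := primitive_comp hx.2.2.1 (T.isClosed_diff x.2) e.2 (T.arrow e.1).toPath
    have h2 := primitive_comp hx.1 hx.2.1 e.2 (T.arrow e.1).toPath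
    have h3 := hx.2.2.2 e.1
    simp only [pathSum_toPath, arrow, diff] at h1 h2
    let u : CoverVertex z → ℝ := primitive hx.1 hx.2.1
    let v : CoverVertex z → ℝ := primitive hx.2.2.1 (T.isClosed_diff x.2)
    change v e.head = v e.tail + _ at h1
    change u e.head = u e.tail + _ at h2
    change v e.tail - x.2 e.1 - (v e.head - x.2 (T.twin e.1)) =
      T.weight e.1 * (u e.head - u e.tail)
    rw [h1, h2]
    linarith
  · exact sub_eq_of_eq_add' (primitive_deck hx.1 hx.2.1 (α k) y)
  · exact sub_eq_of_eq_add' (primitive_deck hx.1 hx.2.1 (β k) y)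

end Integration

/-! ### From Abelian integrals to harmonic pairs -/

section Extraction

variable {D : Type*} {T : TriangulatedSurface D} {z : T.Vertex} {g : ℕ}

theorem nonempty_path (v w : T.Vertex) : Nonempty (Quiver.Path v w) := by
  obtain ⟨d, rfl⟩ : ∃ d, T.tail d = v := Quotient.exists_rep v
  obtain ⟨d', rfl⟩ : ∃ d, T.tail d = w := Quotient.exists_rep w
  -- Both `next x` and `twin x` have tail `head x`, so this serves both moves.
  have h : ∀ x, Nonempty (Quiver.Path (T.tail d) (T.head x)) ↔
      Nonempty (Quiver.Path (T.tail d) (T.tail x)) := fun x =>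
    ⟨fun ⟨p⟩ => ⟨p.cons (Quiver.reverse (T.arrow x))⟩, fun ⟨p⟩ => ⟨p.cons (T.arrow x)⟩⟩
  exact (iff_of_next_twin (T := T) (P := fun x => Nonempty (Quiver.Path (T.tail d) (T.tail x)))
    (fun x => by rw [tail_next, h]) h d d').2 ⟨Quiver.Path.nil⟩

theorem one_comp {w : T.Vertex} (c : T.PathClass z w) : (1 : T.PathClass z z).comp c = c := by
  induction c using Quotient.ind
  exact congrArg cls (Quiver.Path.nil_comp _)

theorem comp_cls_nil {v w : T.Vertex} (c : T.PathClass v w) :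
    c.comp (cls Quiver.Path.nil) = c := by
  induction c using Quotient.ind
  rfl

theorem comp_cls_comp {v w x y : T.Vertex} (c : T.PathClass v w) (p : Quiver.Path w x)
    (q : Quiver.Path x y) : c.comp (cls (p.comp q)) = (c.comp (cls p)).comp (cls q) :=
  (PathClass.comp_assoc c (cls p) (cls q)).symm

theorem Sweep.cls_eq {v w : T.Vertex} {p q : Quiver.Path v w} {n : T.Face → ℤ}
    (h : T.Sweep p q n) : cls p = cls q :=
  Quotient.sound (s := T.homotopic v w) ⟨n, h⟩

/-- A function on the oriented edges of the universal covering with constant increments under the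
deck transformations of generators has constant increments under all deck transformations. -/
theorem exists_increment {α β : Fin g → Quiver.Path z z} (F : CoverDart z → ℝ)
    (gen : Subgroup.closure
      (Set.range (fun k => cls (α k)) ∪ Set.range (fun k => cls (β k))) = ⊤)
    {a b : Fin g → ℝ} (ha : ∀ k e, F (deckDart (α k) e) - F e = a k)
    (hb : ∀ k e, F (deckDart (β k) e) - F e = b k) (c : T.PathClass z z) :
    ∃ r, ∀ e : CoverDart z, F ⟨e.1, c.comp e.2⟩ = F e + r := by
  have hc : c ∈ Subgroup.closure
      (Set.range (fun k => cls (α k)) ∪ Set.range (fun k => cls (β k))) := gen ▸ Subgroup.mem_top c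
  induction hc using Subgroup.closure_induction with
  | mem c hc =>
    rcases hc with ⟨k, rfl⟩ | ⟨k, rfl⟩
    · exact ⟨a k, fun e => by rw [← ha k e]; simp [deckDart]⟩
    · exact ⟨b k, fun e => by rw [← hb k e]; simp [deckDart]⟩
  | one =>
    refine ⟨0, fun e => ?_⟩
    rw [one_comp, add_zero]
    rfl
  | mul c c' _ _ ih ih' =>
    obtain ⟨r, hr⟩ := ih
    obtain ⟨r', hr'⟩ := ih'
    refine ⟨r' + r, fun e => ?_⟩
    have : (c * c').comp e.2 = c.comp (c'.comp e.2) := PathClass.comp_assoc c c' e.2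
    rw [this, hr ⟨e.1, c'.comp e.2⟩, hr', add_assoc]
  | inv c _ ih =>
    obtain ⟨r, hr⟩ := ih
    refine ⟨-r, fun ⟨d, x⟩ => ?_⟩
    have h : F ⟨d, c.comp (c⁻¹.comp x)⟩ = F ⟨d, c⁻¹.comp x⟩ + r := hr ⟨d, c⁻¹.comp x⟩
    have : c.comp (c⁻¹.comp x) = x := by
      rw [← PathClass.comp_assoc]
      change (c * c⁻¹).comp x = x
      rw [mul_inv_cancel, one_comp]
    rw [this] at h
    exact eq_add_neg_of_add_eq h.symm

section Increments

variable {F : CoverVertex z → ℝ} {φ : D → ℝ}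

theorem apply_comp_of_increments
    (hF : ∀ {v w : T.Vertex} (c : T.PathClass z v) (e : v ⟶ w),
      F ⟨w, c.comp (cls e.toPath)⟩ = F ⟨v, c⟩ + φ e.1)
    {v w : T.Vertex} (c : T.PathClass z v) (p : Quiver.Path v w) :
    F ⟨w, c.comp (cls p)⟩ = F ⟨v, c⟩ + pathSum φ p := by
  induction p with
  | nil => rw [comp_cls_nil, pathSum_nil, add_zero]
  | cons p e ih =>
    have : c.comp (cls (p.cons e)) = (c.comp (cls p)).comp (cls e.toPath) :=
      comp_cls_comp c p e.toPath
    rw [this, hF, ih, pathSum_cons, add_assoc]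

/-- Homotopic paths lift to paths with the same endpoint, and `F` is single-valued on the covering.
-/
theorem Sweep.pathSum_eq_of_increments
    (hF : ∀ {v w : T.Vertex} (c : T.PathClass z v) (e : v ⟶ w),
      F ⟨w, c.comp (cls e.toPath)⟩ = F ⟨v, c⟩ + φ e.1)
    {v w : T.Vertex} {p q : Quiver.Path v w} {n : T.Face → ℤ} (h : T.Sweep p q n) : pathSum φ p = pathSum φ q := by
  obtain ⟨b⟩ := nonempty_path z v
  have h1 := apply_comp_of_increments hF (cls b) p
  have h2 := apply_comp_of_increments hF (cls b) q
  rw [h.cls_eq] at h1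
  linarith

theorem isForm_of_increments
    (hF : ∀ {v w : T.Vertex} (c : T.PathClass z v) (e : v ⟶ w),
      F ⟨w, c.comp (cls e.toPath)⟩ = F ⟨v, c⟩ + φ e.1) :
    T.IsForm φ := fun d => by
  have h := Sweep.pathSum_eq_of_increments hF (Sweep.backtrack (T.arrow d))
  simp only [pathSum_comp, pathSum_toPath, pathSum_nil, reverse_val] at h
  exact (neg_eq_of_add_eq_zero_right h).symm

theorem isClosed_of_increments
    (hF : ∀ {v w : T.Vertex} (c : T.PathClass z v) (e : v ⟶ w),
      F ⟨w, c.comp (cls e.toPath)⟩ = F ⟨v, c⟩ + φ e.1) :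
    T.IsClosed φ := fun d => by
  have h := Sweep.pathSum_eq_of_increments hF (Sweep.face (T.arrow d) ⟨T.next d, T.tail_next d, rfl⟩
    ⟨T.next (T.next d), T.tail_next _, T.head_next_next d⟩ rfl rfl)
  simp only [pathSum_comp, pathSum_toPath, pathSum_nil] at h
  exact h

end Increments

theorem exists_coverVertex_eq {v w : T.Vertex} (h : v = w) (c : T.PathClass z w) :
    ∃ c' : T.PathClass z v, (⟨v, c'⟩ : CoverVertex z) = ⟨w, c⟩ := by
  subst h
  exact ⟨c, rfl⟩

/-- Every discrete Abelian integral is given by a harmonic pair. -/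
theorem exists_harmonicPair_of_isAbelianIntegral {α β : Fin g → Quiver.Path z z}
    (h : IsStandardBasis α β) {f : CoverFunction z} {A B : Fin g → ℂ}
    (hf : f.IsAbelianIntegral α β A B) : ∃ x ∈ T.harmonicPairs,
      (∀ k, A k = period x (α k)) ∧ ∀ k, B k = period x (β k) := by
  obtain ⟨hf, hp⟩ := hf
  have hre := exists_increment (fun e => f.re e.tail) h.generate
    (fun k e => hp.re_α k e.tail) (fun k e => hp.re_β k e.tail)
  have him := exists_increment (fun e => f.im e.left) h.generate
    (fun k e => hp.im_α k e.left) (fun k e => hp.im_β k e.left)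
  choose r hr using hre
  choose s hs using him
  have hr' : ∀ (c : T.PathClass z z) {v : T.Vertex} (c' : T.PathClass z v),
      f.re ⟨v, c.comp c'⟩ = f.re ⟨v, c'⟩ + r c := by
    intro c v c'
    obtain ⟨d, rfl⟩ : ∃ d, T.tail d = v := Quotient.exists_rep v
    exact hr c ⟨d, c'⟩
  -- A reference lift of each vertex; `lp c` is the deck transformation taking it to `c`.
  let b : ∀ v : T.Vertex, Quiver.Path z v := fun v => (nonempty_path z v).some
  let lp : ∀ {v : T.Vertex}, T.PathClass z v → T.PathClass z z := fun {v} c =>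
    c.comp (cls (b v).reverse)
  have hlp : ∀ {v : T.Vertex} (c : T.PathClass z v), (lp c).comp (cls (b v)) = c := fun {v} c => by
    simp only [lp]
    rw [← comp_cls_comp, (Sweep.reverse_comp (b v)).cls_eq, comp_cls_nil]
  let φ : D → ℝ := fun d =>
    f.re ⟨T.head d, (cls (b (T.tail d))).comp (cls (T.arrow d).toPath)⟩ -
      f.re ⟨T.tail d, cls (b (T.tail d))⟩
  -- This choice makes the vertex function `G` below vanish up to the increment `s`: it records only
  -- the change of Im f under the deck transformation from the reference lift.
  let κ : D → ℝ := fun d => - f.im (CoverDart.left ⟨d, cls (b (T.tail d))⟩)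
  let G : CoverVertex z → ℝ := fun x => s (lp x.2)
  have hκ : ∀ (d : D) (c : T.PathClass z (T.tail d)),
      f.im (CoverDart.left ⟨d, c⟩) = G ⟨T.tail d, c⟩ - κ d := by
    intro d c
    have := hs (lp c) ⟨d, cls (b (T.tail d))⟩
    simp only [hlp] at this
    simp only [this, κ, G]
    ring
  have hφinc : ∀ {v w : T.Vertex} (c : T.PathClass z v) (e : v ⟶ w),
      f.re ⟨w, c.comp (cls e.toPath)⟩ = f.re ⟨v, c⟩ + φ e.1 := by
    rintro v w c ⟨d, rfl, rfl⟩
    have h1 := hr' (lp c) (cls (b (T.tail d)))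
    have h2 := hr' (lp c) ((cls (b (T.tail d))).comp (cls (T.arrow d).toPath))
    rw [← PathClass.comp_assoc, hlp] at h2
    rw [hlp] at h1
    simp only [arrow, φ] at *
    linarith
  have hGinc : ∀ {v w : T.Vertex} (c : T.PathClass z v) (e : v ⟶ w),
      G ⟨w, c.comp (cls e.toPath)⟩ = G ⟨v, c⟩ + T.diff κ e.1 := by
    rintro v w c ⟨d, rfl, rfl⟩
    obtain ⟨c', hc'⟩ := exists_coverVertex_eq (T.tail_next d) (c.comp (cls (T.arrow d).toPath))
    -- The same face seen from two consecutive sides: comparing the two expressions for Im f gives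
    -- the increment of `G`.
    have h1 : CoverDart.left ⟨d, c⟩ = CoverDart.left ⟨T.next d, c'⟩ := Quot.sound ⟨rfl, hc'⟩
    have h2 := hκ d c
    rw [h1, hκ, hc'] at h2
    simp only [arrow, diff] at *
    linarith
  let o : CoverVertex z := ⟨z, cls Quiver.Path.nil⟩
  have ho : ∀ a : Quiver.Path z z, deckVertex a o = ⟨z, (cls Quiver.Path.nil).comp (cls a)⟩ :=
    fun a => congrArg (Sigma.mk z) ((comp_cls_nil (cls a)).trans (one_comp (cls a)).symm)
  have hreper : ∀ a : Quiver.Path z z, f.re (deckVertex a o) - f.re o = pathSum φ a :=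
    fun a => by rw [ho, apply_comp_of_increments hφinc, add_sub_cancel_left]
  -- One face suffices, since the prescribed periods do not depend on the face.
  have himper : ∀ a : Quiver.Path z z, ∃ w, f.im (deckFace a w) - f.im w =
      pathSum (T.diff κ) a := fun a => by
    obtain ⟨d, hd⟩ : ∃ d, T.tail d = z := Quotient.exists_rep z
    obtain ⟨c, hc⟩ := exists_coverVertex_eq hd (cls (Quiver.Path.nil : Quiver.Path z z))
    refine ⟨CoverDart.left ⟨d, c⟩, ?_⟩
    change f.im (CoverDart.left ⟨d, (cls a).comp c⟩) - _ = _
    rw [hκ, hκ, sub_sub_sub_cancel_right]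
    change G (deckVertex a ⟨T.tail d, c⟩) - _ = _
    rw [hc]
    change G (deckVertex a o) - G o = _
    rw [ho, apply_comp_of_increments hGinc, add_sub_cancel_left]
  refine ⟨(φ, κ), ⟨isForm_of_increments hφinc, isClosed_of_increments hφinc,
    isForm_of_increments hGinc, fun d => ?_⟩, fun k => ?_, fun k => ?_⟩
  · let c := cls (b (T.tail d))
    have h1 := hf ⟨d, c⟩
    have h2 := hGinc c (T.arrow d)
    have h3 := hφinc c (T.arrow d)
    have h4 := hκ (T.twin d) (c.comp (cls (T.arrow d).toPath))
    have h5 := hκ d c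
    change f.im (CoverDart.left ⟨d, c⟩) -
      f.im (CoverDart.left ⟨T.twin d, c.comp (cls (T.arrow d).toPath)⟩) = T.weight d *
        (f.re ⟨T.head d, c.comp (cls (T.arrow d).toPath)⟩ - f.re ⟨T.tail d, c⟩) at h1
    change _ = G ⟨T.head d, c.comp (cls (T.arrow d).toPath)⟩ - _ at h4
    rw [h3, h4, h5, h2, add_sub_cancel_left] at h1
    simp only [diff, arrow] at h1 ⊢
    linarith
  · obtain ⟨w, hw⟩ := himper (α k)
    exact Complex.ext ((hp.re_α k _).symm.trans (hreper _)) ((hp.im_α k w).symm.trans hw)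
  · obtain ⟨w, hw⟩ := himper (β k)
    exact Complex.ext ((hp.re_β k _).symm.trans (hreper _)) ((hp.im_β k w).symm.trans hw)

end Extraction

/-! ### Period matrices as Gram matrices -/

section PeriodMatrices

variable {D : Type*} {T : TriangulatedSurface D} {z : T.Vertex} {g : ℕ}

/-- The period of the harmonic form along a closed path, as a linear map. -/
def formPeriod (p : Quiver.Path z z) : ((D → ℝ) × (D → ℝ)) →ₗ[ℝ] ℝ where
  toFun x := pathSum x.1 p
  map_add' _ _ := pathSum_add _ _ p
  map_smul' _ _ := pathSum_smul _ _ p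

/-- The period of the conjugate form along a closed path, as a linear map. -/
def conjPeriod (p : Quiver.Path z z) : ((D → ℝ) × (D → ℝ)) →ₗ[ℝ] ℝ where
  toFun x := pathSum (T.diff x.2) p
  map_add' x y := by rw [Prod.snd_add, diff_add, pathSum_add]
  map_smul' c x := by rw [Prod.smul_snd, diff_smul, pathSum_smul]; rfl

theorem re_period (x : (D → ℝ) × (D → ℝ)) (p : Quiver.Path z z) :
    (period x p).re = formPeriod p x := rfl

theorem im_period (x : (D → ℝ) × (D → ℝ)) (p : Quiver.Path z z) :
    (period x p).im = conjPeriod p x := rfl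

/-- Here `κ` depends only on the tail, so the conjugate form is exact. -/
theorem conjPeriod_eq_zero {x : (D → ℝ) × (D → ℝ)} (hx : x ∈ T.harmonicPairs) (h : x.1 = 0)
    (p : Quiver.Path z z) : conjPeriod p x = 0 :=
  pathSum_diff_eq_zero (rot_eq_of_fst_eq_zero hx h) p

variable [Fintype D] {α β : Fin g → Quiver.Path z z}

/-- The Dirichlet product of discrete 1-forms (twice the sum over edges). -/
noncomputable def energy (T : TriangulatedSurface D) :
    ((D → ℝ) × (D → ℝ)) →ₗ[ℝ] ((D → ℝ) × (D → ℝ)) →ₗ[ℝ] ℝ :=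
  LinearMap.mk₂ ℝ (fun x y => ∑ d, T.weight d * x.1 d * y.1 d)
    (fun x x' y => by simp [mul_add, add_mul, Finset.sum_add_distrib])
    (fun c x y => by
      simp only [Prod.smul_fst, Pi.smul_apply, smul_eq_mul, Finset.mul_sum]
      exact Finset.sum_congr rfl fun d _ => by ring)
    (fun x y y' => by simp [mul_add, Finset.sum_add_distrib])
    (fun c x y => by
      simp only [Prod.smul_fst, Pi.smul_apply, smul_eq_mul, Finset.mul_sum]
      exact Finset.sum_congr rfl fun d _ => by ring)

theorem energy_apply (x y : (D → ℝ) × (D → ℝ)) :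
    T.energy x y = ∑ d, T.weight d * x.1 d * y.1 d := rfl

theorem energy_comm (x y : (D → ℝ) × (D → ℝ)) : T.energy x y = T.energy y x := by
  simp only [energy_apply]
  exact Finset.sum_congr rfl fun d _ => by ring

theorem energy_pos {x : (D → ℝ) × (D → ℝ)} (hx : x ∈ T.harmonicPairs) (h : x.1 ≠ 0) :
    0 < T.energy x x :=
  (energy_nonneg hx.1 hx.2.1).lt_of_ne fun h0 =>
    h (eq_zero_of_energy_eq_zero hx.1 hx.2.1 h0.symm)

/-- The Gram matrix of linearly independent harmonic forms is symmetric and positive definite. -/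
theorem isSymm_and_posDef_of_energy {N : ℝ} (hN : 0 < N) {x : Fin g → (D → ℝ) × (D → ℝ)}
    (hx : ∀ l, x l ∈ T.harmonicPairs)
    (hli : ∀ c : Fin g → ℝ, (∑ l, c l • x l).1 = 0 → c = 0)
    {M : Matrix (Fin g) (Fin g) ℝ} (hM : ∀ l m, M l m = N * T.energy (x l) (x m)) :
    M.IsSymm ∧ M.PosDef := by
  have hs : M.IsSymm := Matrix.IsSymm.ext fun l m => by rw [hM, hM, energy_comm]
  refine ⟨hs, Matrix.PosDef.of_dotProduct_mulVec_pos ?_ fun c hc => ?_⟩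
  · rw [Matrix.IsHermitian, Matrix.conjTranspose_eq_transpose_of_trivial]
    exact hs
  · have h : star c ⬝ᵥ M *ᵥ c = N * T.energy (∑ l, c l • x l) (∑ l, c l • x l) := by
      simp only [map_sum, LinearMap.sum_apply, map_smul, LinearMap.smul_apply, smul_eq_mul,
        star_trivial, dotProduct, Matrix.mulVec, hM, Finset.mul_sum]
      rw [Finset.sum_comm]
      exact Finset.sum_congr rfl fun l _ => Finset.sum_congr rfl fun m _ => by ring
    rw [h]
    exact mul_pos hN (energy_pos (Submodule.sum_mem _ fun l _ => Submodule.smul_mem _ _ (hx l))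
      fun h0 => hc (hli c h0))

/-- There is a discrete Abelian integral with given A-periods. -/
theorem IsStandardBasis.exists_isAbelianIntegral (hT : T.HasGenus g) (h : IsStandardBasis α β)
    (A : Fin g → ℂ) : ∃ (f : CoverFunction z) (B : Fin g → ℂ), f.IsAbelianIntegral α β A B := by
  obtain ⟨x, hx, h1, h2⟩ := h.exists_harmonicPair hT (fun k => (A k).re) fun k => (A k).im
  refine ⟨integral hx z, fun k => period x (β k), ?_⟩
  convert integral_isAbelianIntegral hx α β using 2 with k
  exact Complex.ext (h1 k).symm (h2 k).symm

/-- The A-periods determine the B-periods. -/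
theorem IsStandardBasis.bPeriods_unique (h : IsStandardBasis α β) {A B B' : Fin g → ℂ}
    {f f' : CoverFunction z} (hf : f.IsAbelianIntegral α β A B)
    (hf' : f'.IsAbelianIntegral α β A B') : B = B' := by
  obtain ⟨x, hx, hA, hB⟩ := exists_harmonicPair_of_isAbelianIntegral h hf
  obtain ⟨y, hy, hA', hB'⟩ := exists_harmonicPair_of_isAbelianIntegral h hf'
  have hxy : x - y ∈ T.harmonicPairs := Submodule.sub_mem _ hx hy
  have hAA : ∀ k, period x (α k) = period y (α k) := fun k => (hA k).symm.trans (hA' k)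
  have h0 : (x - y).1 = 0 := by
    refine h.fst_eq_zero hxy (fun k => ?_) fun k => ?_
    · change formPeriod (α k) (x - y) = 0
      rw [map_sub, ← re_period, ← re_period, hAA, sub_self]
    · change conjPeriod (α k) (x - y) = 0
      rw [map_sub, ← im_period, ← im_period, hAA, sub_self]
  funext k
  rw [hB, hB']
  refine Complex.ext ?_ ?_
  · rw [re_period, re_period, ← sub_eq_zero, ← map_sub]
    change pathSum (x - y).1 (β k) = 0
    rw [h0]
    exact map_zero (pathSumₗ (β k))
  · rw [im_period, im_period, ← sub_eq_zero, ← map_sub, conjPeriod_eq_zero hxy h0]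

/-- The bilinear relation in terms of complex periods. -/
theorem IsStandardBasis.exists_energy_eq (h : IsStandardBasis α β) :
    ∃ N : ℝ, 0 < N ∧ ∀ x ∈ T.harmonicPairs, ∀ y ∈ T.harmonicPairs,
      N * T.energy x y = ∑ k, ((period x (α k)).re * (period y (β k)).im -
        (period x (β k)).re * (period y (α k)).im) :=
  h.exists_bilinear

end PeriodMatrices

end TriangulatedSurface

/-! ### The lemma on period matrices -/

open TriangulatedSurface in
theorem mainTheorem8 {D : Type*} [Finite D] (T : TriangulatedSurface D) {g : ℕ} (hg : 1 ≤ g)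
    (hT : T.HasGenus g) (z : T.Vertex) (α β : Fin g → Quiver.Path z z)
    (hαβ : TriangulatedSurface.IsStandardBasis α β) :
    (∃! P : Matrix (Fin g) (Fin g) ℂ, TriangulatedSurface.IsPeriodMatrix α β P) ∧
    (∃! P' : Matrix (Fin g) (Fin g) ℂ, TriangulatedSurface.IsDualPeriodMatrix α β P') ∧
    ∀ P P' : Matrix (Fin g) (Fin g) ℂ, TriangulatedSurface.IsPeriodMatrix α β P →
      TriangulatedSurface.IsDualPeriodMatrix α β P' →
      (P.map Complex.im).IsSymm ∧ (P.map Complex.im).PosDef ∧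
      (P'.map Complex.im).IsSymm ∧ (P'.map Complex.im).PosDef ∧
      P'.map Complex.re = (P.map Complex.re)ᵀ := by
  have := Fintype.ofFinite D
  refine ⟨?_, ?_, fun P P' hP hP' => ?_⟩
  · choose f B hf using fun l : Fin g =>
      hαβ.exists_isAbelianIntegral hT fun k => if k = l then 1 else 0
    refine ⟨Matrix.of fun k l => B l k, fun l => ⟨f l, B l, hf l, fun k => rfl⟩, fun P hP => ?_⟩
    ext k l
    obtain ⟨f', B', hf', hB'⟩ := hP l
    rw [hB', hαβ.bPeriods_unique hf' (hf l), Matrix.of_apply]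
  · choose f B hf using fun l : Fin g =>
      hαβ.exists_isAbelianIntegral hT fun k => if k = l then Complex.I else 0
    refine ⟨Matrix.of fun k l => B l k / Complex.I, fun l => ⟨f l, B l, hf l, fun k => rfl⟩,
      fun P hP => ?_⟩
    ext k l
    obtain ⟨f', B', hf', hB'⟩ := hP l
    rw [hB', hαβ.bPeriods_unique hf' (hf l), Matrix.of_apply]
  · have hx : ∀ l, ∃ x ∈ T.harmonicPairs,
        (∀ k, period x (α k) = if k = l then 1 else 0) ∧ ∀ k, period x (β k) = P k l := by
      intro l
      obtain ⟨f, B, hf, hB⟩ := hP l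
      obtain ⟨x, hx, h1, h2⟩ := exists_harmonicPair_of_isAbelianIntegral hαβ hf
      exact ⟨x, hx, fun k => (h1 k).symm, fun k => by rw [hB, h2]⟩
    have hy : ∀ l, ∃ y ∈ T.harmonicPairs, (∀ k, period y (α k) = if k = l then Complex.I else 0) ∧
        ∀ k, period y (β k) = P' k l * Complex.I := by
      intro l
      obtain ⟨f, B, hf, hB⟩ := hP' l
      obtain ⟨x, hx, h1, h2⟩ := exists_harmonicPair_of_isAbelianIntegral hαβ hf
      exact ⟨x, hx, fun k => (h1 k).symm, fun k => by
        rw [hB, h2, div_mul_cancel₀ _ Complex.I_ne_zero]⟩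
    choose x hx hxα hxβ using hx
    choose y hy hyα hyβ using hy
    obtain ⟨N, hN, hE⟩ := hαβ.exists_energy_eq
    have hxx : ∀ l m, (P.map Complex.im) l m = N * T.energy (x l) (x m) := fun l m => by
      rw [hE _ (hx l) _ (hx m)]
      simp [hxα, hxβ, apply_ite Complex.re, apply_ite Complex.im]
    -- The B-periods of `y m` are `P' k m * i`, with real part `-Im P' k m`; the minus sign of the
    -- bilinear relation cancels this one.
    have hyy : ∀ l m, (P'.map Complex.im) l m = N * T.energy (y l) (y m) := fun l m => by
      rw [energy_comm, hE _ (hy m) _ (hy l)]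
      simp [hyα, hyβ, apply_ite Complex.re, apply_ite Complex.im]
    have hxy : ∀ l m, N * T.energy (x l) (y m) = (P' l m).re - (P m l).re := fun l m => by
      rw [hE _ (hx l) _ (hy m)]
      simp [hxα, hxβ, hyα, hyβ, apply_ite Complex.re, apply_ite Complex.im]
    -- The A-periods of `y m` are imaginary and those of `x l` are real, so both products vanish.
    -- Symmetry of the energy then forces the right-hand side of `hxy` to be zero.
    have hyx : ∀ l m, N * T.energy (y m) (x l) = 0 := fun l m => by
      rw [hE _ (hy m) _ (hx l)]
      simp [hxα, hxβ, hyα, hyβ, apply_ite Complex.re, apply_ite Complex.im]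
    have hX := isSymm_and_posDef_of_energy hN hx (fun c hc => by
      funext k
      have h0 : formPeriod (α k) (∑ l, c l • x l) = 0 := by
        change pathSum (∑ l, c l • x l).1 (α k) = 0
        rw [hc]
        exact map_zero (pathSumₗ (α k))
      simpa [← re_period, hxα, apply_ite Complex.re] using h0) hxx
    -- The real A-periods of the `y l` vanish, so independence is read off from the conjugate
    -- periods, which a zero form also annihilates.
    have hY := isSymm_and_posDef_of_energy hN hy (fun c hc => by
      funext k
      have h0 := conjPeriod_eq_zero
        (Submodule.sum_mem _ fun l _ => Submodule.smul_mem _ (c l) (hy l)) hc (α k)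
      simpa [← im_period, hyα, apply_ite Complex.im] using h0) hyy
    refine ⟨hX.1, hX.2, hY.1, hY.2, ?_⟩
    ext l m
    have h := hxy l m
    rw [energy_comm, hyx] at h
    exact (sub_eq_zero.1 h.symm)
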